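/- Let $\mathbf U=\{z=x+is:\ x\in\mathbb R,\ s>0\}$ and let $\alpha>0$ be real. Let $H^2(\mathbf U)$ be the Hardy space of analytic functions $f$ on $\mathbf U$ with $$\|f\|_{H^2}^2=\sup_{s>0}\int_{-\infty}^{\infty}|f(x+is)|^2\,dx<\infty ,$$ and let $A_{2\alpha+1}(\mathbf U)$ be the weighted Bergman space of analytic functions $F$ on $\mathbf U$ with $$\|F\|_{A_{2\alpha+1}}^2=\iint_{\mathbf U}|F(x+is)|^2\,s^{2\alpha-1}\,dx\,ds<\infty .$$ For every $f\in H^2(\mathbf U)$ the functions $f(\cdot+is)$ converge in $L^2(\mathbb R)$, as $s\to0^+$, to a boundary function, again denoted $f$. Let $\mathcal F$ be the unitary Fourier transform on $L^2(\mathbb R)$, that is, the continuous extension of $(\mathcal Ff)(t)=\frac1{\sqrt{2\pi}}\int_{-\infty}^{\infty}e^{-itx}f(x)\,dx$. For every $f\in H^2(\mathbf U)$ and $z\in\mathbf U$ the integral $$\mathrm{Ber}^{\alpha}f(z)=\int_0^\infty t^{\alpha}e^{izt}(\mathcal Ff)(t)\,dt$$ converges absolutely. Up to the normalization of the norms, the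 Bergman transform $\mathrm{Ber}^\alpha$ is an isometric isomorphism of $H^2(\mathbf U)$ onto $A_{2\alpha+1}(\mathbf U)$. Precisely, with $$K_\alpha=\frac{2\pi\,\Gamma(2\alpha)}{4^{\alpha}},$$ the map $K_\alpha^{-1/2}\,\mathrm{Ber}^{\alpha}$ is a linear isometric bijection of $H^2(\mathbf U)$ onto $A_{2\alpha+1}(\mathbf U)$. Equivalently, $\mathrm{Ber}^\alpha$ is a linear bijection of $H^2(\mathbf U)$ onto $A_{2\alpha+1}(\mathbf U)$ and $\|\mathrm{Ber}^\alpha f\|_{A_{2\alpha+1}}^2=K_\alpha\|f\|_{H^2}^2$ for all $f\in H^2(\mathbf U)$, so that $\mathrm{Ber}^\alpha$ itself is an isometric isomorphism when $A_{2\alpha+1}(\mathbf U)$ carries the normalized norm $K_\alpha^{-1/2}\|\cdot\|_{A_{2\alpha+1}}$. -/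

import Mathlib

open MeasureTheory Filter Topology FourierTransform
open scoped UpperHalfPlane Manifold ENNReal

noncomputable section

namespace BergmanTransform

/-! ### The Hardy space of the upper half-plane -/

/-- The point `x + i s` of the upper half-plane, for real `x` and `s > 0`. -/
def point (x : ℝ) (s : Set.Ioi (0 : ℝ)) : ℍ :=
  ⟨(x : ℂ) + (s : ℝ) * Complex.I, by have h : (0 : ℝ) < s := s.2; simpa using h⟩

/-- The restriction `x ↦ f (x + i s)` of `f` to the horizontal line at height `s`. -/
def slice (f : ℍ → ℂ) (s : Set.Ioi (0 : ℝ)) : ℝ → ℂ := fun x => f (point x s)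

/-- `sup_{s > 0} (∫ |f (x + i s)|² dx)^{1/2}`, as an extended nonnegative number. -/
def hardyENorm (f : ℍ → ℂ) : ℝ≥0∞ :=
  ⨆ s : Set.Ioi (0 : ℝ), eLpNorm (slice f s) 2 volume

lemma continuous_slice {f : ℍ → ℂ} (hf : Continuous f) (s : Set.Ioi (0 : ℝ)) :
    Continuous (slice f s) := by
  refine hf.comp ?_
  rw [UpperHalfPlane.isEmbedding_coe.continuous_iff]
  change Continuous fun x : ℝ => (x : ℂ) + (s : ℝ) * Complex.I
  fun_prop

lemma hardyENorm_add_le {f g : ℍ → ℂ} (hf : Continuous f) (hg : Continuous g) :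
    hardyENorm (f + g) ≤ hardyENorm f + hardyENorm g := by
  refine iSup_le fun s => ?_
  have h : eLpNorm (slice f s + slice g s) 2 volume
      ≤ eLpNorm (slice f s) 2 volume + eLpNorm (slice g s) 2 volume :=
    eLpNorm_add_le (continuous_slice hf s).aestronglyMeasurable
      (continuous_slice hg s).aestronglyMeasurable (by norm_num)
  refine le_trans h (add_le_add ?_ ?_)
  · exact le_iSup (fun s => eLpNorm (slice f s) 2 volume) s
  · exact le_iSup (fun s => eLpNorm (slice g s) 2 volume) s

lemma hardyENorm_smul (c : ℂ) (f : ℍ → ℂ) :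
    hardyENorm (c • f) = ‖c‖ₑ * hardyENorm f := by
  rw [hardyENorm, hardyENorm, ENNReal.mul_iSup]
  exact iSup_congr fun s => eLpNorm_const_smul c (slice f s) 2 volume

lemma hardyENorm_zero : hardyENorm (0 : ℍ → ℂ) = 0 := by
  have h := hardyENorm_smul 0 (0 : ℍ → ℂ)
  simpa using h

/-- The Hardy space `H²(U)`: holomorphic functions on the upper half-plane whose `L²` norms on
horizontal lines are uniformly bounded. -/
def HardySpace : Submodule ℂ (ℍ → ℂ) where
  carrier := {f | MDifferentiable 𝓘(ℂ) 𝓘(ℂ) f ∧ hardyENorm f < ∞}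
  add_mem' := fun hf hg => ⟨hf.1.add hg.1,
    (hardyENorm_add_le hf.1.continuous hg.1.continuous).trans_lt
      (ENNReal.add_lt_top.2 ⟨hf.2, hg.2⟩)⟩
  zero_mem' := ⟨mdifferentiable_const, by rw [hardyENorm_zero]; exact ENNReal.zero_lt_top⟩
  smul_mem' := fun c f hf => ⟨hf.1.const_smul c, by
    rw [hardyENorm_smul]; exact ENNReal.mul_lt_top enorm_lt_top hf.2⟩

lemma HardySpace.continuous (f : HardySpace) : Continuous (f : ℍ → ℂ) := f.2.1.continuous

lemma HardySpace.memLp_slice (f : HardySpace) (s : Set.Ioi (0 : ℝ)) :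
    MemLp (slice f s) 2 volume :=
  ⟨(continuous_slice (HardySpace.continuous f) s).aestronglyMeasurable,
    (le_iSup (fun s => eLpNorm (slice f s) 2 volume) s).trans_lt f.2.2⟩

lemma HardySpace.eq_zero_of_norm (f : HardySpace)
    (h : (hardyENorm (f : ℍ → ℂ)).toReal = 0) : f = 0 := by
  have h0 : hardyENorm (f : ℍ → ℂ) = 0 :=
    ((ENNReal.toReal_eq_zero_iff _).1 h).resolve_right f.2.2.ne
  ext z
  let s : Set.Ioi (0 : ℝ) := ⟨z.im, z.im_pos⟩
  have hs : eLpNorm (slice f s) 2 volume = 0 := by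
    have := le_iSup (fun s => eLpNorm (slice f s) 2 volume) s
    exact le_antisymm (this.trans h0.le) bot_le
  have hae := (eLpNorm_eq_zero_iff
    (continuous_slice (HardySpace.continuous f) s).aestronglyMeasurable (by norm_num)).1 hs
  have heq := (continuous_slice (HardySpace.continuous f) s).ae_eq_iff_eq volume continuous_zero |>.1 hae
  have hz : point z.re s = z := by
    apply UpperHalfPlane.ext
    exact Complex.re_add_im (z : ℂ)
  have := congrFun heq z.re
  simpa [slice, hz] using this

/-- The norm `‖f‖ = sup_{s > 0} (∫ |f (x + i s)|² dx)^{1/2}` on `H²(U)`. -/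
instance : NormedAddCommGroup HardySpace :=
  AddGroupNorm.toNormedAddCommGroup
    { toFun := fun f => (hardyENorm (f : ℍ → ℂ)).toReal
      map_zero' := by
        change (hardyENorm (0 : ℍ → ℂ)).toReal = 0
        rw [hardyENorm_zero, ENNReal.toReal_zero]
      add_le' := fun f g => by
        rw [← ENNReal.toReal_add f.2.2.ne g.2.2.ne]
        exact ENNReal.toReal_mono (ENNReal.add_lt_top.2 ⟨f.2.2, g.2.2⟩).ne
          (hardyENorm_add_le (HardySpace.continuous f) (HardySpace.continuous g))
      neg' := fun f => by
        have h := hardyENorm_smul (-1) (f : ℍ → ℂ)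
        rw [neg_one_smul] at h
        change (hardyENorm (-(f : ℍ → ℂ))).toReal = _
        rw [h]
        simp
      eq_zero_of_map_eq_zero' := fun f h => HardySpace.eq_zero_of_norm f h }

instance : NormedSpace ℂ HardySpace where
  norm_smul_le := fun c f => by
    change (hardyENorm (c • (f : ℍ → ℂ))).toReal ≤ ‖c‖ * (hardyENorm (f : ℍ → ℂ)).toReal
    rw [hardyENorm_smul, ENNReal.toReal_mul, toReal_enorm]

/-! ### The weighted Bergman spaces of the upper half-plane -/

/-- The measure `s ^ (β - 2) dx ds` on the upper half-plane, where `z = x + i s`. -/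
def bergmanMeasure (β : ℝ) : Measure ℍ :=
  (Measure.comap UpperHalfPlane.coe volume).withDensity fun z => ENNReal.ofReal (z.im ^ (β - 2))

/-- The weighted Bergman space `A_β(U)`: holomorphic functions on the upper half-plane that are
square integrable with respect to `s ^ (β - 2) dx ds`. -/
def BergmanSpace (β : ℝ) : Submodule ℂ (ℍ → ℂ) where
  carrier := {f | MDifferentiable 𝓘(ℂ) 𝓘(ℂ) f ∧ MemLp f 2 (bergmanMeasure β)}
  add_mem' := fun hf hg => ⟨hf.1.add hg.1, hf.2.add hg.2⟩
  zero_mem' := ⟨mdifferentiable_const, MemLp.zero⟩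
  smul_mem' := fun c _ hf => ⟨hf.1.const_smul c, hf.2.const_smul c⟩

/-- The class in `L²` of a function in the Bergman space. -/
def BergmanSpace.toL2 (β : ℝ) : BergmanSpace β →ₗ[ℂ] Lp ℂ 2 (bergmanMeasure β) where
  toFun := fun f => f.2.2.toLp f
  map_add' := fun f g => f.2.2.toLp_add g.2.2
  map_smul' := fun c f => f.2.2.toLp_const_smul c

lemma comap_absolutelyContinuous (β : ℝ) :
    Measure.comap UpperHalfPlane.coe volume ≪ bergmanMeasure β := by
  refine withDensity_absolutelyContinuous' ?_ ?_
  · have : Measurable fun z : ℍ => z.im := UpperHalfPlane.continuous_im.measurable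
    exact (this.pow_const _).ennreal_ofReal.aemeasurable
  · refine Eventually.of_forall fun z => ?_
    have := Real.rpow_pos_of_pos z.im_pos (β - 2)
    simpa using this

instance : (Measure.comap UpperHalfPlane.coe (volume : Measure ℂ)).IsOpenPosMeasure where
  open_pos := fun V hV hne => by
    rw [UpperHalfPlane.measurableEmbedding_coe.comap_apply]
    exact ((UpperHalfPlane.isOpenEmbedding_coe.isOpenMap V hV).measure_pos volume
      (hne.image _)).ne'

lemma BergmanSpace.toL2_injective (β : ℝ) : Function.Injective (BergmanSpace.toL2 β) := by
  intro f g h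
  have hae : (f : ℍ → ℂ) =ᵐ[bergmanMeasure β] g := (f.2.2.toLp_eq_toLp_iff g.2.2).1 h
  have hae' := (comap_absolutelyContinuous β).ae_eq hae
  exact Subtype.ext ((f.2.1.continuous.ae_eq_iff_eq _ g.2.1.continuous).1 hae')

/-- The norm `‖F‖ = (∬ |F z|² s ^ (β - 2) dx ds)^{1/2}` on `A_β(U)`. -/
instance (β : ℝ) : NormedAddCommGroup (BergmanSpace β) :=
  NormedAddCommGroup.induced _ _ (BergmanSpace.toL2 β) (BergmanSpace.toL2_injective β)

instance (β : ℝ) : NormedSpace ℂ (BergmanSpace β) :=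
  NormedSpace.induced _ _ _ (BergmanSpace.toL2 β)

/-! ### The Bergman transform -/

/-- The filter `s → 0⁺` on the positive reals. -/
def heightToZero : Filter (Set.Ioi (0 : ℝ)) := comap Subtype.val (𝓝 0)

/-- The restriction of `f ∈ H²(U)` to the horizontal line at height `s`, in `L²(ℝ)`. -/
def sliceL2 (f : HardySpace) (s : Set.Ioi (0 : ℝ)) : Lp ℂ 2 (volume : Measure ℝ) :=
  (HardySpace.memLp_slice f s).toLp _

/-- The boundary function of `f ∈ H²(U)`: the limit in `L²(ℝ)` of `f (· + i s)` as `s → 0⁺`. -/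
def boundary (f : HardySpace) : Lp ℂ 2 (volume : Measure ℝ) :=
  haveI : Nonempty (Lp ℂ 2 (volume : Measure ℝ)) := ⟨0⟩
  limUnder heightToZero (sliceL2 f)

/-- The unitary Fourier transform on `L²(ℝ)`, the extension of
`t ↦ (2π)^{-1/2} ∫ e^{-itx} g x dx`. Mathlib's `𝓕` is the extension of `ξ ↦ ∫ e^{-2πiξx} g x dx`,
hence the rescaling. -/
def unitaryFourier (g : Lp ℂ 2 (volume : Measure ℝ)) (t : ℝ) : ℂ :=
  ((Real.sqrt (2 * Real.pi))⁻¹ : ℝ) * (𝓕 g : Lp ℂ 2 (volume : Measure ℝ)) (t / (2 * Real.pi))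

/-- The integrand `t^α e^{izt} (ℱ f)(t)` of the Bergman transform. -/
def berIntegrand (α : ℝ) (f : HardySpace) (z : ℍ) (t : ℝ) : ℂ :=
  ((t ^ α : ℝ) : ℂ) * Complex.exp (Complex.I * z * t) * unitaryFourier (boundary f) t

/-- The Bergman transform `Ber^α f (z) = ∫_0^∞ t^α e^{izt} (ℱ f)(t) dt`. -/
def Ber (α : ℝ) (f : HardySpace) (z : ℍ) : ℂ :=
  ∫ t in Set.Ioi (0 : ℝ), berIntegrand α f z t

end BergmanTransform

end

/-!
The idea is a Paley–Wiener theorem covering both spaces at once. Let `G` be holomorphic on the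
upper half-plane and square integrable with respect to `s ^ r dx ds` on each half-plane `s > a > 0`.
Shifting contours in a strip, tested against Fourier transforms of compactly supported functions,
shows that `h ξ = e^{2πsξ} 𝓕(G(· + is))(ξ)` does not depend on `s`; the convergence of
`∫ s ^ r ∫ e^{-4πsξ} |h ξ|² dξ ds` at `s = ∞` forces `h` to vanish for `ξ < 0`. Hence
`G z = ∫_0^∞ e^{2πizξ} h ξ dξ`. By Plancherel, `G` lies in the Hardy space iff `h` is in `L²`, with
the same norm, and `G` lies in the Bergman space iff `h` is in `L²` for the weight
`∫_0^∞ s^{2α-1} e^{-4πsξ} ds = Γ(2α) (4πξ)^{-2α}`, again with the same norm. The Bergman transform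
multiplies `h` by `√(2π) (2πξ)^α`, which carries the first weight to the second up to the constant
`K_α`.
-/

noncomputable section

namespace BergmanTransform

/-! ### The Fourier transform on `L²` -/

section FourierLp

open scoped SchwartzMap

variable {V E : Type*} [NormedAddCommGroup V] [InnerProductSpace ℝ V] [FiniteDimensional ℝ V]
  [MeasurableSpace V] [BorelSpace V] [NormedAddCommGroup E]

lemma continuous_fourierInv [NormedSpace ℂ E] {f : V → E} (hf : Integrable f) :
    Continuous (𝓕⁻ f) :=
  VectorFourier.fourierIntegral_continuous (L := -innerₗ V) Real.continuous_fourierChar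
    continuous_inner.neg hf

lemma integral_fourierInv_smul [NormedSpace ℂ E] [CompleteSpace E] (φ : 𝓢(V, ℂ)) {f : V → E}
    (hf : Integrable f) : ∫ x, 𝓕⁻ φ x • f x = ∫ ξ, φ ξ • 𝓕⁻ f ξ := by
  have hflip : (-innerₗ V).flip = -innerₗ V := by
    ext x y
    simp [real_inner_comm]
  have h := VectorFourier.integral_fourierIntegral_smul_eq_flip (L := -innerₗ V) (μ := volume)
    (ν := volume) Real.continuous_fourierChar continuous_inner.neg φ.integrable hf
  rw [hflip] at h
  rw [SchwartzMap.fourierInv_coe]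
  exact h

variable [InnerProductSpace ℂ E] [CompleteSpace E]

lemma integral_smul_fourier_Lp (φ : 𝓢(V, ℂ)) (f : Lp E 2 (volume : Measure V)) :
    ∫ ξ, φ ξ • (𝓕 f : Lp E 2 (volume : Measure V)) ξ = ∫ x, 𝓕 φ x • f x := by
  have h := congrArg (· φ) (Lp.fourier_toTemperedDistribution_eq f)
  simpa only [TemperedDistribution.fourier_apply, Lp.toTemperedDistribution_apply] using h.symm

lemma integral_smul_fourierInv_Lp (φ : 𝓢(V, ℂ)) (f : Lp E 2 (volume : Measure V)) :
    ∫ ξ, φ ξ • (𝓕⁻ f : Lp E 2 (volume : Measure V)) ξ = ∫ x, 𝓕⁻ φ x • f x := by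
  have h := congrArg (· φ) (Lp.fourierInv_toTemperedDistribution_eq f)
  simpa only [TemperedDistribution.fourierInv_apply, Lp.toTemperedDistribution_apply] using h.symm

lemma fourierInv_toLp_ae_eq {f : V → E} (h1 : Integrable f) (h2 : MemLp f 2) :
    (𝓕⁻ (h2.toLp f) : Lp E 2 (volume : Measure V)) =ᵐ[volume] 𝓕⁻ f := by
  refine ae_eq_of_integral_contDiff_smul_eq ((Lp.memLp _).locallyIntegrable (by norm_num))
    (continuous_fourierInv h1).locallyIntegrable fun g hg hgs => ?_
  let φ : 𝓢(V, ℂ) := (hgs.comp_left Complex.ofReal_zero).toSchwartzMap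
    (Complex.ofRealCLM.contDiff.comp hg)
  calc ∫ ξ, g ξ • (𝓕⁻ (h2.toLp f) : Lp E 2 (volume : Measure V)) ξ
      = ∫ ξ, φ ξ • (𝓕⁻ (h2.toLp f) : Lp E 2 (volume : Measure V)) ξ := rfl
    _ = ∫ x, 𝓕⁻ φ x • h2.toLp f x := integral_smul_fourierInv_Lp φ _
    _ = ∫ x, 𝓕⁻ φ x • f x := integral_congr_ae <| by
        filter_upwards [h2.coeFn_toLp] with x hx
        rw [hx]
    _ = ∫ ξ, φ ξ • 𝓕⁻ f ξ := integral_fourierInv_smul φ h1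
    _ = ∫ ξ, g ξ • 𝓕⁻ f ξ := rfl

lemma memLp_fourierInv {f : V → E} (h1 : Integrable f) (h2 : MemLp f 2) : MemLp (𝓕⁻ f) 2 :=
  (memLp_congr_ae (fourierInv_toLp_ae_eq h1 h2)).1 (Lp.memLp _)

lemma toLp_fourierInv {f : V → E} (h1 : Integrable f) (h2 : MemLp f 2) :
    (memLp_fourierInv h1 h2).toLp _ = 𝓕⁻ (h2.toLp f) :=
  Lp.ext ((MemLp.coeFn_toLp _).trans (fourierInv_toLp_ae_eq h1 h2).symm)

lemma eLpNorm_fourier_toLp {f : V → E} (hf : MemLp f 2) :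
    eLpNorm (𝓕 (hf.toLp f) : Lp E 2 (volume : Measure V)) 2 volume = eLpNorm f 2 volume := by
  rw [← Lp.enorm_def, ← ofReal_norm, Lp.norm_fourier_eq, ofReal_norm, Lp.enorm_toLp]

lemma eLpNorm_fourierInv {f : V → E} (h1 : Integrable f) (h2 : MemLp f 2) :
    eLpNorm (𝓕⁻ f) 2 volume = eLpNorm f 2 volume := by
  rw [← Lp.enorm_toLp (hf := memLp_fourierInv h1 h2), toLp_fourierInv h1 h2, ← ofReal_norm,
    ← Lp.norm_fourier_eq, FourierTransform.fourier_fourierInv_eq, ofReal_norm, Lp.enorm_toLp]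

end FourierLp

/-! ### Square-integrable functions -/

section MemLpTwo

variable {X E : Type*} [MeasurableSpace X] {μ : Measure X} [NormedAddCommGroup E]

lemma eLpNorm_two_sq (f : X → E) : eLpNorm f 2 μ ^ 2 = ∫⁻ x, ‖f x‖ₑ ^ 2 ∂μ := by
  simpa using eLpNorm_nnreal_pow_eq_lintegral (f := f) (μ := μ) (p := 2) two_ne_zero

lemma memLp_two_iff_lintegral {f : X → E} (hf : AEStronglyMeasurable f μ) :
    MemLp f 2 μ ↔ ∫⁻ x, ‖f x‖ₑ ^ 2 ∂μ < ∞ := by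
  rw [← eLpNorm_two_sq]
  simp [MemLp, hf]

lemma tendsto_eLpNorm_sub_of_dominated {ι : Type*} {l : Filter ι} [l.IsCountablyGenerated]
    {p : ℝ≥0∞} (hp0 : p ≠ 0) (hp : p ≠ ∞) {u : ι → X → E} {f : X → E} {g : X → ℝ}
    (hu : ∀ᶠ i in l, AEStronglyMeasurable (u i) μ) (hf : AEStronglyMeasurable f μ)
    (hg : MemLp g p μ) (hug : ∀ᶠ i in l, ∀ᵐ x ∂μ, ‖u i x - f x‖ ≤ g x)
    (hlim : ∀ᵐ x ∂μ, Tendsto (fun i => u i x) l (𝓝 (f x))) :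
    Tendsto (fun i => eLpNorm (u i - f) p μ) l (𝓝 0) := by
  have hp' : 0 < p.toReal := ENNReal.toReal_pos hp0 hp
  suffices h : Tendsto (fun i => ∫⁻ x, ‖u i x - f x‖ₑ ^ p.toReal ∂μ) l (𝓝 0) by
    simp only [eLpNorm_eq_lintegral_rpow_enorm_toReal hp0 hp, Pi.sub_apply]
    have h' := h.ennrpow_const (1 / p.toReal)
    rwa [ENNReal.zero_rpow_of_pos (by positivity)] at h'
  rw [← lintegral_zero (μ := μ)]
  refine tendsto_lintegral_filter_of_dominated_convergence' (fun x => ‖g x‖ₑ ^ p.toReal) ?_ ?_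
    (lintegral_rpow_enorm_lt_top_of_eLpNorm_lt_top hp0 hp hg.2).ne ?_
  · filter_upwards [hu] with i hi using (hi.sub hf).enorm.pow_const _
  · filter_upwards [hug] with i hi
    filter_upwards [hi] with x hx
    gcongr
    exact enorm_le_iff_norm_le.2 (hx.trans (le_abs_self _))
  · filter_upwards [hlim] with x hx
    have h := ((hx.sub_const (f x)).enorm).ennrpow_const p.toReal
    simpa only [sub_self, enorm_zero, ENNReal.zero_rpow_of_pos hp'] using h

end MemLpTwo

/-! ### Horizontal integrals of holomorphic functions -/

section Strip

variable {E : Type*} [NormedAddCommGroup E]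

lemma tendsto_nhds_eq_zero_of_integrable {u : ℝ → E} {c : E} (hu : Integrable u)
    (hc : Tendsto u atTop (𝓝 c)) : c = 0 :=
  IntegrableAtFilter.eq_zero_of_tendsto (μ := volume) (hu.integrableAtFilter _)
    (fun _ hs => have ⟨b, hb⟩ := mem_atTop_sets.1 hs
      eq_top_mono (measure_mono (show Set.Ici b ⊆ _ from hb)) Real.volume_Ici) hc

lemma aestronglyMeasurable_strip {G : ℂ → E} {S : Set ℝ} (hS : MeasurableSet S)
    (hG : ContinuousOn G {z | z.im ∈ S}) :
    AEStronglyMeasurable (fun p : ℝ × ℝ => G (p.1 + p.2 * Complex.I))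
      (volume.prod (volume.restrict S)) := by
  have hprod : (volume : Measure ℝ).prod (volume.restrict S)
      = ((volume : Measure ℝ).prod volume).restrict (Set.univ ×ˢ S) := by
    rw [← Measure.prod_restrict, Measure.restrict_univ]
  rw [hprod]
  refine ContinuousOn.aestronglyMeasurable ?_ (MeasurableSet.univ.prod hS)
  exact hG.comp (by fun_prop) fun p hp => by simpa using hp.2

variable [NormedSpace ℂ E]

lemma intervalIntegral_horizontal_sub {G : ℂ → E} {a b : ℝ} (hab : a ≤ b)
    (hG : DifferentiableOn ℂ G {z | z.im ∈ Set.Icc a b}) (R : ℝ) :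
    (∫ x in -R..R, G (x + a * Complex.I)) - ∫ x in -R..R, G (x + b * Complex.I)
      = Complex.I • ((∫ y in a..b, G ((-R : ℝ) + y * Complex.I))
        - ∫ y in a..b, G (R + y * Complex.I)) := by
  have h := Complex.integral_boundary_rect_eq_zero_of_differentiableOn G
    (-R + a * Complex.I) (R + b * Complex.I) <| hG.mono fun z hz => by
      simpa [Set.uIcc_of_le hab] using hz.2
  simp only [Complex.add_re, Complex.neg_re, Complex.ofReal_re, Complex.mul_re, Complex.I_re,
    mul_zero, Complex.ofReal_im, Complex.I_im, mul_one, sub_self, add_zero, Complex.add_im,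
    Complex.neg_im, neg_zero, Complex.mul_im, zero_add] at h
  rw [smul_sub, ← sub_eq_zero, ← h]
  abel

lemma integral_horizontal_eq {G : ℂ → E} {a b : ℝ} (hab : a ≤ b)
    (hG : DifferentiableOn ℂ G {z | z.im ∈ Set.Icc a b})
    (hstrip : Integrable (fun p : ℝ × ℝ => G (p.1 + p.2 * Complex.I))
      (volume.prod (volume.restrict (Set.Ioo a b))))
    (ha : Integrable fun x : ℝ => G (x + a * Complex.I))
    (hb : Integrable fun x : ℝ => G (x + b * Complex.I)) :
    ∫ x : ℝ, G (x + a * Complex.I) = ∫ x : ℝ, G (x + b * Complex.I) := by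
  let side : ℝ → E := fun x => ∫ y in a..b, G (x + y * Complex.I)
  have hside : Integrable side := by
    simp only [side, intervalIntegral.integral_of_le hab, ← restrict_Ioo_eq_restrict_Ioc]
    exact hstrip.integral_prod_left
  have hlim := (intervalIntegral_tendsto_integral ha tendsto_neg_atTop_atBot tendsto_id).sub
    (intervalIntegral_tendsto_integral hb tendsto_neg_atTop_atBot tendsto_id)
  simp only [id, intervalIntegral_horizontal_sub hab hG] at hlim
  exact sub_eq_zero.1
    (tendsto_nhds_eq_zero_of_integrable ((hside.comp_neg.sub hside).smul Complex.I) hlim)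

end Strip

/-! ### Exponential damping and the Fourier–Laplace transform -/

section Damp

variable {E : Type*} [NormedAddCommGroup E] [NormedSpace ℝ E]

/-- The function `ξ ↦ e^{-2πsξ} h ξ`. The inverse Fourier transform of `damp s h` is the restriction
of the Fourier–Laplace transform of `h` to the horizontal line at height `s`. -/
def damp (s : ℝ) (h : ℝ → E) (ξ : ℝ) : E := Real.exp (-2 * Real.pi * s * ξ) • h ξ

lemma damp_damp (s t : ℝ) (h : ℝ → E) : damp s (damp t h) = damp (s + t) h := by
  ext ξ
  rw [damp, damp, damp, smul_smul, ← Real.exp_add]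
  ring_nf

@[simp]
lemma damp_zero (h : ℝ → E) : damp 0 h = h := by
  ext ξ
  simp [damp]

lemma norm_damp (s : ℝ) (h : ℝ → E) (ξ : ℝ) :
    ‖damp s h ξ‖ = Real.exp (-2 * Real.pi * s * ξ) * ‖h ξ‖ := by
  rw [damp, norm_smul, Real.norm_of_nonneg (Real.exp_pos _).le]

lemma enorm_damp_sq (s : ℝ) (h : ℝ → E) (ξ : ℝ) :
    ‖damp s h ξ‖ₑ ^ 2 = ENNReal.ofReal (Real.exp (-4 * Real.pi * ξ * s)) * ‖h ξ‖ₑ ^ 2 := by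
  rw [← ofReal_norm, norm_damp, ENNReal.ofReal_mul (Real.exp_pos _).le, ofReal_norm, mul_pow,
    ← ENNReal.ofReal_pow (Real.exp_pos _).le, ← Real.exp_nat_mul]
  push_cast
  ring_nf

lemma damp_congr_ae {h k : ℝ → E} (hhk : h =ᵐ[volume] k) (s : ℝ) :
    damp s h =ᵐ[volume] damp s k := by
  filter_upwards [hhk] with ξ hξ
  rw [damp, damp, hξ]

lemma damp_ae_eq_iff {s : ℝ} {h k : ℝ → E} :
    damp (-s) h =ᵐ[volume] k ↔ h =ᵐ[volume] damp s k := by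
  constructor <;> intro hhk
  · simpa [damp_damp] using damp_congr_ae hhk s
  · simpa [damp_damp] using damp_congr_ae hhk (-s)

lemma aestronglyMeasurable_damp {h : ℝ → E} (hh : AEStronglyMeasurable h volume) (s : ℝ) :
    AEStronglyMeasurable (damp s h) volume :=
  (by fun_prop : Continuous fun ξ => Real.exp (-2 * Real.pi * s * ξ)).aestronglyMeasurable.smul hh

lemma aestronglyMeasurable_of_damp {s : ℝ} {h : ℝ → E}
    (hh : AEStronglyMeasurable (damp s h) volume) : AEStronglyMeasurable h volume := by
  simpa [damp_damp] using aestronglyMeasurable_damp hh (-s)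

lemma locallyIntegrable_damp {h : ℝ → E} (hh : LocallyIntegrable h) (s : ℝ) :
    LocallyIntegrable (damp s h) :=
  hh.continuous_smul (by fun_prop)

lemma tendsto_damp {ι : Type*} {l : Filter ι} {s : ι → ℝ} (hs : Tendsto s l (𝓝 0)) (h : ℝ → E)
    (ξ : ℝ) : Tendsto (fun i => damp (s i) h ξ) l (𝓝 (h ξ)) := by
  have hcont : Continuous fun s : ℝ => damp s h ξ := by
    unfold damp
    fun_prop
  simpa [Function.comp_def] using (hcont.tendsto 0).comp hs

lemma norm_damp_le_add {a b s : ℝ} (hs : s ∈ Set.Icc a b) (h : ℝ → E) (ξ : ℝ) :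
    ‖damp s h ξ‖ ≤ ‖damp a h ξ‖ + ‖damp b h ξ‖ := by
  simp only [norm_damp]
  rw [← add_mul]
  gcongr
  rcases le_total 0 ξ with hξ | hξ
  · refine le_add_of_le_of_nonneg (Real.exp_le_exp.2 ?_) (Real.exp_pos _).le
    nlinarith [mul_le_mul_of_nonneg_left hs.1 (mul_nonneg Real.pi_pos.le hξ)]
  · refine le_add_of_nonneg_of_le (Real.exp_pos _).le (Real.exp_le_exp.2 ?_)
    nlinarith [mul_le_mul_of_nonpos_left hs.2 (mul_nonpos_of_nonneg_of_nonpos Real.pi_pos.le hξ)]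

lemma eLpNorm_damp_le {a b s : ℝ} (hs : s ∈ Set.Icc a b) (h : ℝ → E) (p : ℝ≥0∞) :
    eLpNorm (damp s h) p volume ≤ eLpNorm (fun ξ => ‖damp a h ξ‖ + ‖damp b h ξ‖) p volume :=
  eLpNorm_mono_real (norm_damp_le_add hs h)

lemma memLp_damp_of_mem_Icc {a b s : ℝ} (hs : s ∈ Set.Icc a b) {h : ℝ → E} {p : ℝ≥0∞}
    (ha : MemLp (damp a h) p) (hb : MemLp (damp b h) p) : MemLp (damp s h) p :=
  ⟨aestronglyMeasurable_damp (aestronglyMeasurable_of_damp ha.1) s,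
    (eLpNorm_damp_le hs h p).trans_lt (ha.norm.add hb.norm).2⟩

lemma integrable_damp_of_mem_Icc {a b s : ℝ} (hs : s ∈ Set.Icc a b) {h : ℝ → E}
    (ha : Integrable (damp a h)) (hb : Integrable (damp b h)) : Integrable (damp s h) := by
  rw [← memLp_one_iff_integrable] at *
  exact memLp_damp_of_mem_Icc hs ha hb

lemma contDiff_damp {n : WithTop ℕ∞} {h : ℝ → E} (hh : ContDiff ℝ n h) (s : ℝ) :
    ContDiff ℝ n (damp s h) := by
  unfold damp
  fun_prop

lemma hasCompactSupport_damp {h : ℝ → E} (hh : HasCompactSupport h) (s : ℝ) :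
    HasCompactSupport (damp s h) :=
  hh.smul_left

end Damp

section FourierLaplace

variable {E : Type*} [NormedAddCommGroup E] [NormedSpace ℂ E]

/-- The Fourier–Laplace transform `z ↦ ∫ e^{2πizξ} h ξ dξ`, with the normalization of Mathlib's
Fourier transform. -/
def fourierLaplace (h : ℝ → E) (z : ℂ) : E :=
  ∫ ξ : ℝ, Complex.exp (2 * Real.pi * Complex.I * z * ξ) • h ξ

lemma norm_exp_smul_eq_norm_damp (h : ℝ → E) (z : ℂ) (ξ : ℝ) :
    ‖Complex.exp (2 * Real.pi * Complex.I * z * ξ) • h ξ‖ = ‖damp z.im h ξ‖ := by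
  rw [norm_smul, norm_damp, Complex.norm_exp]
  simp

lemma aestronglyMeasurable_exp_smul {h : ℝ → E} (hh : AEStronglyMeasurable h volume) (z : ℂ) :
    AEStronglyMeasurable (fun ξ : ℝ => Complex.exp (2 * Real.pi * Complex.I * z * ξ) • h ξ)
      volume :=
  (by fun_prop : Continuous fun ξ : ℝ =>
    Complex.exp (2 * Real.pi * Complex.I * z * ξ)).aestronglyMeasurable.smul hh

lemma integrable_exp_smul {h : ℝ → E} {z : ℂ} (hh : Integrable (damp z.im h)) :
    Integrable fun ξ : ℝ => Complex.exp (2 * Real.pi * Complex.I * z * ξ) • h ξ :=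
  hh.norm.mono' (aestronglyMeasurable_exp_smul (aestronglyMeasurable_of_damp hh.1) z)
    (Eventually.of_forall fun ξ => (norm_exp_smul_eq_norm_damp h z ξ).le)

lemma fourierLaplace_add {h k : ℝ → E} {z : ℂ} (hh : Integrable (damp z.im h))
    (hk : Integrable (damp z.im k)) :
    fourierLaplace (h + k) z = fourierLaplace h z + fourierLaplace k z := by
  simp only [fourierLaplace, Pi.add_apply, smul_add]
  exact integral_add (integrable_exp_smul hh) (integrable_exp_smul hk)

lemma fourierLaplace_const_smul (c : ℂ) (h : ℝ → E) (z : ℂ) :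
    fourierLaplace (c • h) z = c • fourierLaplace h z := by
  simp only [fourierLaplace, Pi.smul_apply, smul_comm _ c, integral_smul]

lemma fourierLaplace_add_mul_I (h : ℝ → E) (x s : ℝ) :
    fourierLaplace h (x + s * Complex.I) = 𝓕⁻ (damp s h) x := by
  rw [Real.fourierInv_eq', fourierLaplace]
  refine integral_congr_ae (Eventually.of_forall fun ξ => ?_)
  simp only [damp, RCLike.inner_apply, conj_trivial]
  rw [← Complex.coe_smul, smul_smul, Complex.ofReal_exp, ← Complex.exp_add]
  congr 2
  push_cast
  linear_combination (2 * Real.pi * s * ξ : ℂ) * Complex.I_sq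

lemma fourierLaplace_comp_neg (h : ℝ → E) (x s : ℝ) :
    fourierLaplace (fun ξ => h (-ξ)) (x + s * Complex.I) = 𝓕 (damp (-s) h) x := by
  have hdamp : (fun ξ => damp s (fun ξ => h (-ξ)) (-ξ)) = damp (-s) h := by
    ext ξ
    simp [damp]
  rw [fourierLaplace_add_mul_I, Real.fourierInv_eq_fourier_comp_neg, hdamp]

lemma two_pi_mul_abs_mul_norm_damp_le {a b s δ : ℝ} (hδ : 0 < δ)
    (hs : s ∈ Set.Icc (a + δ) (b - δ)) (h : ℝ → E) (ξ : ℝ) :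
    2 * Real.pi * |ξ| * ‖damp s h ξ‖ ≤ δ⁻¹ * (2 * (‖damp a h ξ‖ + ‖damp b h ξ‖)) := by
  have hexp : 2 * Real.pi * |ξ| ≤ δ⁻¹ * Real.exp (2 * Real.pi * δ * |ξ|) := by
    rw [← div_eq_inv_mul, le_div_iff₀ hδ]
    linarith [Real.add_one_le_exp (2 * Real.pi * δ * |ξ|)]
  have habs : Real.exp (2 * Real.pi * δ * |ξ|) * ‖damp s h ξ‖
      ≤ ‖damp (s - δ) h ξ‖ + ‖damp (s + δ) h ξ‖ := by
    simp only [norm_damp]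
    rw [← mul_assoc, ← Real.exp_add, ← add_mul]
    gcongr
    rcases abs_cases ξ with ⟨hξ, -⟩ | ⟨hξ, -⟩ <;> rw [hξ]
    · exact le_add_of_le_of_nonneg (Real.exp_le_exp.2 (by linarith)) (Real.exp_pos _).le
    · exact le_add_of_nonneg_of_le (Real.exp_pos _).le (Real.exp_le_exp.2 (by linarith))
  calc 2 * Real.pi * |ξ| * ‖damp s h ξ‖
      ≤ δ⁻¹ * Real.exp (2 * Real.pi * δ * |ξ|) * ‖damp s h ξ‖ := by gcongr
    _ ≤ δ⁻¹ * (‖damp (s - δ) h ξ‖ + ‖damp (s + δ) h ξ‖) := by rw [mul_assoc]; gcongr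
    _ ≤ δ⁻¹ * (2 * (‖damp a h ξ‖ + ‖damp b h ξ‖)) := by
        have hsub := norm_damp_le_add (show s - δ ∈ Set.Icc a b by grind) h ξ
        have hadd := norm_damp_le_add (show s + δ ∈ Set.Icc a b by grind) h ξ
        gcongr
        linarith

lemma differentiableAt_fourierLaplace {h : ℝ → E} {a b : ℝ} (ha : Integrable (damp a h))
    (hb : Integrable (damp b h)) {z : ℂ} (hz : z.im ∈ Set.Ioo a b) :
    DifferentiableAt ℂ (fourierLaplace h) z := by
  obtain ⟨δ, hδ, hδz⟩ : ∃ δ > 0, z.im ∈ Set.Ioo (a + δ) (b - δ) := by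
    obtain ⟨δ, hδ, hδz⟩ := exists_between (lt_min (sub_pos.2 hz.1) (sub_pos.2 hz.2))
    exact ⟨δ, hδ, by grind⟩
  have hh : AEStronglyMeasurable h volume := aestronglyMeasurable_of_damp ha.1
  have hint : Integrable (damp z.im h) :=
    integrable_damp_of_mem_Icc (Set.Ioo_subset_Icc_self hz) ha hb
  refine (hasDerivAt_integral_of_dominated_loc_of_deriv_le
    (F := fun (w : ℂ) (ξ : ℝ) => Complex.exp (2 * Real.pi * Complex.I * w * ξ) • h ξ)
    (F' := fun (w : ℂ) (ξ : ℝ) => (2 * Real.pi * ξ * Complex.I) •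
      (Complex.exp (2 * Real.pi * Complex.I * w * ξ) • h ξ))
    (bound := fun ξ => δ⁻¹ * (2 * (‖damp a h ξ‖ + ‖damp b h ξ‖)))
    ((isOpen_Ioo.preimage Complex.continuous_im).mem_nhds hδz)
    (Eventually.of_forall (aestronglyMeasurable_exp_smul hh)) (integrable_exp_smul hint)
    ?_ ?_ ?_ ?_).2.differentiableAt
  · exact (by fun_prop : Continuous fun ξ : ℝ =>
      (2 * Real.pi * ξ * Complex.I : ℂ)).aestronglyMeasurable.smul
        (aestronglyMeasurable_exp_smul hh z)
  · refine Eventually.of_forall fun ξ w hw => ?_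
    rw [norm_smul, norm_exp_smul_eq_norm_damp]
    simpa [abs_of_pos Real.pi_pos] using
      two_pi_mul_abs_mul_norm_damp_le hδ (Set.Ioo_subset_Icc_self hw) h ξ
  · exact ((ha.norm.add hb.norm).const_mul 2).const_mul _
  · refine Eventually.of_forall fun ξ w _ => ?_
    have hlin : HasDerivAt (fun w : ℂ => 2 * Real.pi * Complex.I * w * ξ)
        (2 * Real.pi * ξ * Complex.I) w :=
      (((hasDerivAt_id w).const_mul (2 * Real.pi * Complex.I : ℂ)).mul_const
        (ξ : ℂ)).congr_deriv (by ring)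
    exact (hlin.cexp.smul_const (h ξ)).congr_deriv (by rw [smul_smul, mul_comm])

end FourierLaplace

section FourierLaplaceLp

variable {E : Type*} [NormedAddCommGroup E] [InnerProductSpace ℂ E] [CompleteSpace E]
  {h : ℝ → E} {s : ℝ}

lemma memLp_fourierLaplace_line (h1 : Integrable (damp s h)) (h2 : MemLp (damp s h) 2) :
    MemLp (fun x : ℝ => fourierLaplace h (x + s * Complex.I)) 2 := by
  simp only [fourierLaplace_add_mul_I]
  exact memLp_fourierInv h1 h2

lemma toLp_fourierLaplace_line (h1 : Integrable (damp s h)) (h2 : MemLp (damp s h) 2) :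
    (memLp_fourierLaplace_line h1 h2).toLp _ = 𝓕⁻ (h2.toLp (damp s h)) := by
  rw [← toLp_fourierInv h1 h2, MemLp.toLp_eq_toLp_iff]
  exact Eventually.of_forall fun x => fourierLaplace_add_mul_I h x s

lemma eLpNorm_fourierLaplace_line (h1 : Integrable (damp s h)) (h2 : MemLp (damp s h) 2) :
    eLpNorm (fun x : ℝ => fourierLaplace h (x + s * Complex.I)) 2 volume
      = eLpNorm (damp s h) 2 volume := by
  simp only [fourierLaplace_add_mul_I]
  exact eLpNorm_fourierInv h1 h2

end FourierLaplaceLp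

/-! ### The Fourier transforms of the restrictions to two horizontal lines -/

section LineFourier

open scoped ContDiff

variable {E : Type*} [NormedAddCommGroup E] [InnerProductSpace ℂ E] [CompleteSpace E]

lemma memLp_fourierLaplace_strip {h : ℝ → E} {a b : ℝ} (ha1 : Integrable (damp a h))
    (ha2 : MemLp (damp a h) 2) (hb1 : Integrable (damp b h)) (hb2 : MemLp (damp b h) 2) :
    MemLp (fun p : ℝ × ℝ => fourierLaplace h (p.1 + p.2 * Complex.I)) 2
      (volume.prod (volume.restrict (Set.Ioo a b))) := by
  have hmeas := aestronglyMeasurable_strip measurableSet_Ioo fun z hz =>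
    (differentiableAt_fourierLaplace ha1 hb1 hz).continuousAt.continuousWithinAt
  rw [memLp_two_iff_lintegral hmeas, lintegral_prod_symm _ (hmeas.enorm.pow_const 2)]
  let C : ℝ≥0∞ := eLpNorm (fun ξ => ‖damp a h ξ‖ + ‖damp b h ξ‖) 2 volume
  calc ∫⁻ y in Set.Ioo a b, ∫⁻ x : ℝ, ‖fourierLaplace h (x + y * Complex.I)‖ₑ ^ 2
      ≤ ∫⁻ _ in Set.Ioo a b, C ^ 2 := setLIntegral_mono' measurableSet_Ioo fun y hy => by
        have hy' : y ∈ Set.Icc a b := Set.Ioo_subset_Icc_self hy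
        rw [← eLpNorm_two_sq, eLpNorm_fourierLaplace_line
          (integrable_damp_of_mem_Icc hy' ha1 hb1) (memLp_damp_of_mem_Icc hy' ha2 hb2)]
        gcongr
        exact eLpNorm_damp_le hy' h 2
    _ < ⊤ := by
        rw [setLIntegral_const, Real.volume_Ioo]
        exact ENNReal.mul_lt_top (ENNReal.pow_lt_top (ha2.norm.add hb2.norm).2)
          ENNReal.ofReal_lt_top

lemma integral_smul_damp_fourier {F : ℝ → E} (hF : MemLp F 2) {g : ℝ → ℂ} (hg : ContDiff ℝ ∞ g)
    (hgs : HasCompactSupport g) (s : ℝ) :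
    ∫ ξ, g ξ • damp (-s) (𝓕 (hF.toLp F) : Lp E 2 (volume : Measure ℝ)) ξ
      = ∫ x : ℝ, fourierLaplace (fun ξ => g (-ξ)) (x + s * Complex.I) • F x := by
  let φ : SchwartzMap ℝ ℂ :=
    (hasCompactSupport_damp hgs (-s)).toSchwartzMap (contDiff_damp hg (-s))
  calc ∫ ξ, g ξ • damp (-s) (𝓕 (hF.toLp F) : Lp E 2 (volume : Measure ℝ)) ξ
      = ∫ ξ, φ ξ • (𝓕 (hF.toLp F) : Lp E 2 (volume : Measure ℝ)) ξ := by
        refine integral_congr_ae (Eventually.of_forall fun ξ => ?_)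
        change g ξ • damp (-s) _ ξ = damp (-s) g ξ • _
        rw [damp, damp, smul_comm, smul_assoc]
    _ = ∫ x, 𝓕 φ x • hF.toLp F x := integral_smul_fourier_Lp φ _
    _ = ∫ x : ℝ, fourierLaplace (fun ξ => g (-ξ)) (x + s * Complex.I) • F x := by
        refine integral_congr_ae ?_
        filter_upwards [hF.coeFn_toLp] with x hx
        rw [hx, fourierLaplace_comp_neg, SchwartzMap.fourier_coe]
        rfl

lemma damp_fourier_toLp_line_ae_eq {G : ℂ → E} {a b : ℝ} (hab : a ≤ b)
    (hG : DifferentiableOn ℂ G {z | z.im ∈ Set.Icc a b})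
    (hstrip : MemLp (fun p : ℝ × ℝ => G (p.1 + p.2 * Complex.I)) 2
      (volume.prod (volume.restrict (Set.Ioo a b))))
    (ha : MemLp (fun x : ℝ => G (x + a * Complex.I)) 2)
    (hb : MemLp (fun x : ℝ => G (x + b * Complex.I)) 2) :
    damp (-a) (𝓕 (ha.toLp _) : Lp E 2 (volume : Measure ℝ))
      =ᵐ[volume] damp (-b) (𝓕 (hb.toLp _) : Lp E 2 (volume : Measure ℝ)) := by
  refine ae_eq_of_integral_contDiff_smul_eq
    (locallyIntegrable_damp ((Lp.memLp _).locallyIntegrable (by norm_num)) _)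
    (locallyIntegrable_damp ((Lp.memLp _).locallyIntegrable (by norm_num)) _) fun g hg hgs => ?_
  let k : ℝ → ℂ := fun ξ => g (-ξ)
  have hgc : ContDiff ℝ ∞ fun ξ => (g ξ : ℂ) := Complex.ofRealCLM.contDiff.comp hg
  have hgcs : HasCompactSupport fun ξ => (g ξ : ℂ) := hgs.comp_left Complex.ofReal_zero
  have hk : ∀ (s : ℝ) (p : ℝ≥0∞), MemLp (damp s k) p := fun s p =>
    (contDiff_damp (hgc.comp contDiff_neg) s).continuous.memLp_of_hasCompactSupport
      (hasCompactSupport_damp (hgcs.comp_homeomorph (Homeomorph.neg ℝ)) s)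
  have hk1 : ∀ s, Integrable (damp s k) := fun s => memLp_one_iff_integrable.1 (hk s 1)
  have hline : ∀ {s : ℝ}, MemLp (fun x : ℝ => G (x + s * Complex.I)) 2 →
      Integrable fun x : ℝ => fourierLaplace k (x + s * Complex.I) • G (x + s * Complex.I) :=
    fun {s} hs => memLp_one_iff_integrable.1 <|
      hs.smul (memLp_fourierLaplace_line (hk1 s) (hk s 2))
  have hkdiff : Differentiable ℂ (fourierLaplace k) := fun z =>
    differentiableAt_fourierLaplace (hk1 (z.im - 1)) (hk1 (z.im + 1)) (by constructor <;> linarith)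
  -- Both sides, tested against `g`, are integrals over a horizontal line of the single function
  -- `fourierLaplace k • G`, which is holomorphic and integrable on the strip.
  calc ∫ ξ, (g ξ : ℂ) • damp (-a) (𝓕 (ha.toLp _) : Lp E 2 (volume : Measure ℝ)) ξ
      = ∫ x : ℝ, fourierLaplace k (x + a * Complex.I) • G (x + a * Complex.I) :=
        integral_smul_damp_fourier ha hgc hgcs a
    _ = ∫ x : ℝ, fourierLaplace k (x + b * Complex.I) • G (x + b * Complex.I) :=
        integral_horizontal_eq (G := fun z => fourierLaplace k z • G z) hab
          (hkdiff.differentiableOn.smul hG)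
          (memLp_one_iff_integrable.1 <| hstrip.smul <|
            memLp_fourierLaplace_strip (hk1 a) (hk a 2) (hk1 b) (hk b 2))
          (hline ha) (hline hb)
    _ = ∫ ξ, (g ξ : ℂ) • damp (-b) (𝓕 (hb.toLp _) : Lp E 2 (volume : Measure ℝ)) ξ :=
        (integral_smul_damp_fourier hb hgc hgcs b).symm

end LineFourier

/-! ### A Paley–Wiener theorem -/

section LaplaceDensity

variable {E : Type*} [NormedAddCommGroup E] [NormedSpace ℝ E] {h : ℝ → E}

lemma norm_damp_le_of_le (h0 : ∀ ξ ≤ 0, h ξ = 0) {s t : ℝ} (hst : s ≤ t) (ξ : ℝ) :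
    ‖damp t h ξ‖ ≤ ‖damp s h ξ‖ := by
  rcases le_or_gt ξ 0 with hξ | hξ
  · simp [damp, h0 ξ hξ]
  rw [norm_damp, norm_damp]
  refine mul_le_mul_of_nonneg_right (Real.exp_le_exp.2 ?_) (norm_nonneg _)
  nlinarith [mul_le_mul_of_nonneg_left hst (mul_pos Real.pi_pos hξ).le]

lemma memLp_damp_of_le (h0 : ∀ ξ ≤ 0, h ξ = 0) {s t : ℝ} (hst : s ≤ t) {p : ℝ≥0∞}
    (hs : MemLp (damp s h) p) : MemLp (damp t h) p :=
  hs.of_le (aestronglyMeasurable_damp (aestronglyMeasurable_of_damp hs.1) t)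
    (Eventually.of_forall (norm_damp_le_of_le h0 hst))

lemma memLp_indicator_exp {c : ℝ} (hc : 0 < c) :
    MemLp ((Set.Ioi (0 : ℝ)).indicator fun ξ => Real.exp (-c * ξ)) 2 volume := by
  rw [memLp_indicator_iff_restrict measurableSet_Ioi,
    memLp_two_iff_integrable_sq (by fun_prop : Continuous _).aestronglyMeasurable]
  refine (exp_neg_integrableOn_Ioi 0 (mul_pos two_pos hc)).congr_fun (fun ξ _ => ?_)
    measurableSet_Ioi
  rw [← Real.exp_nat_mul]
  push_cast
  ring_nf

lemma integrable_damp_of_lt (h0 : ∀ ξ ≤ 0, h ξ = 0) {s t : ℝ} (hst : s < t)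
    (hs : MemLp (damp s h) 2) : Integrable (damp t h) := by
  have hsplit : damp t h = (Set.Ioi (0 : ℝ)).indicator
      (fun ξ => Real.exp (-(2 * Real.pi * (t - s)) * ξ)) • damp s h := by
    ext ξ
    rcases le_or_gt ξ 0 with hξ | hξ
    · simp [damp, h0 ξ hξ]
    · rw [Pi.smul_apply', Set.indicator_of_mem (Set.mem_Ioi.2 hξ), damp, damp, smul_smul,
        ← Real.exp_add]
      ring_nf
  rw [hsplit]
  exact memLp_one_iff_integrable.1 <| hs.smul <|
    memLp_indicator_exp (mul_pos Real.two_pi_pos (sub_pos.2 hst))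

/-- Functions supported on the positive half-line all of whose exponential dampings are in `L²`:
the functions whose Fourier–Laplace transform on the upper half-plane is square integrable on every
horizontal line. -/
structure IsLaplaceDensity (h : ℝ → E) : Prop where
  eq_zero : ∀ ξ ≤ 0, h ξ = 0
  memLp_damp : ∀ s > 0, MemLp (damp s h) 2

namespace IsLaplaceDensity

lemma integrable_damp (hh : IsLaplaceDensity h) {s : ℝ} (hs : 0 < s) : Integrable (damp s h) :=
  integrable_damp_of_lt hh.eq_zero (half_lt_self hs) (hh.memLp_damp _ (half_pos hs))

lemma aestronglyMeasurable (hh : IsLaplaceDensity h) : AEStronglyMeasurable h volume :=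
  aestronglyMeasurable_of_damp (hh.memLp_damp 1 one_pos).1

lemma of_memLp (h0 : ∀ ξ ≤ 0, h ξ = 0) (h2 : MemLp h 2) : IsLaplaceDensity h :=
  ⟨h0, fun _ hs => memLp_damp_of_le h0 hs.le (by rwa [damp_zero])⟩

lemma smul_of_abs_le_mul_exp (hh : IsLaplaceDensity h) {w : ℝ → ℝ}
    (hw : AEStronglyMeasurable w volume)
    (hwle : ∀ ε > 0, ∃ C, ∀ ξ > 0, |w ξ| ≤ C * Real.exp (ε * ξ)) : IsLaplaceDensity (w • h) where
  eq_zero ξ hξ := by simp [hh.eq_zero ξ hξ]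
  memLp_damp s hs := by
    obtain ⟨C, hC⟩ := hwle (Real.pi * s) (mul_pos Real.pi_pos hs)
    refine (hh.memLp_damp (s / 2) (half_pos hs)).of_le_mul (c := C)
      (aestronglyMeasurable_damp (hw.smul hh.aestronglyMeasurable) s)
      (Eventually.of_forall fun ξ => ?_)
    rcases le_or_gt ξ 0 with hξ | hξ
    · simp [damp, hh.eq_zero ξ hξ]
    calc ‖damp s (w • h) ξ‖
        = Real.exp (-2 * Real.pi * s * ξ) * |w ξ| * ‖h ξ‖ := by
          rw [norm_damp, Pi.smul_apply', norm_smul, Real.norm_eq_abs, mul_assoc (Real.exp _)]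
      _ ≤ Real.exp (-2 * Real.pi * s * ξ) * (C * Real.exp (Real.pi * s * ξ)) * ‖h ξ‖ := by
          gcongr
          exact hC ξ hξ
      _ = C * ‖damp (s / 2) h ξ‖ := by
          rw [norm_damp, mul_left_comm, ← Real.exp_add]
          ring_nf

lemma differentiableOn_fourierLaplace {E : Type*} [NormedAddCommGroup E] [NormedSpace ℂ E]
    {h : ℝ → E} (hh : IsLaplaceDensity h) :
    DifferentiableOn ℂ (fourierLaplace h) {z | 0 < z.im} := fun z (hz : 0 < z.im) =>
  (differentiableAt_fourierLaplace (hh.integrable_damp (half_pos hz))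
    (hh.integrable_damp (add_pos hz one_pos))
    ⟨half_lt_self hz, lt_add_one _⟩).differentiableWithinAt

end IsLaplaceDensity

lemma lintegral_rpow_mul_exp_eq_top (r : ℝ) {c : ℝ} (hc : 0 < c) :
    ∫⁻ y in Set.Ioi (1 : ℝ), ENNReal.ofReal (y ^ r) * ENNReal.ofReal (Real.exp (c * y)) = ∞ := by
  obtain ⟨M, hM⟩ := eventually_atTop.1
    ((tendsto_exp_mul_div_rpow_atTop (-r) c hc).eventually_ge_atTop 1)
  have hsub : Set.Ioi (max M 1) ⊆ Set.Ioi 1 := Set.Ioi_subset_Ioi (le_max_right M 1)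
  refine top_unique ?_
  calc ∞ = ∫⁻ _ in Set.Ioi (max M 1), (1 : ℝ≥0∞) := by simp
    _ ≤ ∫⁻ y in Set.Ioi (max M 1), ENNReal.ofReal (y ^ r) * ENNReal.ofReal (Real.exp (c * y)) := by
        refine setLIntegral_mono' measurableSet_Ioi fun y hy => ?_
        have hy0 : 0 < y := one_pos.trans (hsub hy)
        have hy1 := hM y ((le_max_left M 1).trans (le_of_lt hy))
        rw [Real.rpow_neg hy0.le, div_inv_eq_mul, mul_comm] at hy1
        rwa [← ENNReal.ofReal_mul (Real.rpow_nonneg hy0.le _), ENNReal.one_le_ofReal]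
    _ ≤ _ := lintegral_mono_set hsub

lemma lintegral_rpow_mul_lintegral_damp {h : ℝ → E} (hh : AEStronglyMeasurable h volume) (r : ℝ)
    {S : Set ℝ} :
    ∫⁻ y in S, ENNReal.ofReal (y ^ r) * ∫⁻ ξ, ‖damp y h ξ‖ₑ ^ 2
      = ∫⁻ ξ, (∫⁻ y in S, ENNReal.ofReal (y ^ r)
          * ENNReal.ofReal (Real.exp (-4 * Real.pi * ξ * y))) * ‖h ξ‖ₑ ^ 2 := by
  have hmeas : AEMeasurable (Function.uncurry fun (y ξ : ℝ) => ENNReal.ofReal (y ^ r)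
      * ENNReal.ofReal (Real.exp (-4 * Real.pi * ξ * y)) * ‖h ξ‖ₑ ^ 2)
      ((volume.restrict S).prod volume) := by
    have hweight : Measurable fun p : ℝ × ℝ => ENNReal.ofReal (p.1 ^ r)
        * ENNReal.ofReal (Real.exp (-4 * Real.pi * p.2 * p.1)) := by fun_prop
    exact hweight.aemeasurable.mul (hh.enorm.pow_const 2).comp_snd
  calc ∫⁻ y in S, ENNReal.ofReal (y ^ r) * ∫⁻ ξ, ‖damp y h ξ‖ₑ ^ 2
      = ∫⁻ y in S, ∫⁻ ξ, ENNReal.ofReal (y ^ r)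
          * ENNReal.ofReal (Real.exp (-4 * Real.pi * ξ * y)) * ‖h ξ‖ₑ ^ 2 := by
        simp only [← lintegral_const_mul' _ _ ENNReal.ofReal_ne_top, enorm_damp_sq, mul_assoc]
    _ = ∫⁻ ξ, ∫⁻ y in S, ENNReal.ofReal (y ^ r)
          * ENNReal.ofReal (Real.exp (-4 * Real.pi * ξ * y)) * ‖h ξ‖ₑ ^ 2 :=
        lintegral_lintegral_swap hmeas
    _ = _ := by simp only [lintegral_mul_const' _ _ (ENNReal.pow_ne_top enorm_ne_top)]

lemma ae_eq_zero_of_lintegral_damp_lt_top (hh : AEStronglyMeasurable h volume) {r : ℝ}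
    (hfin : ∫⁻ y in Set.Ioi (1 : ℝ), ENNReal.ofReal (y ^ r) * ∫⁻ ξ, ‖damp y h ξ‖ₑ ^ 2 < ∞) :
    ∀ᵐ ξ : ℝ, ξ < 0 → h ξ = 0 := by
  rw [lintegral_rpow_mul_lintegral_damp hh] at hfin
  have hmeas : AEMeasurable fun ξ => (∫⁻ y in Set.Ioi (1 : ℝ), ENNReal.ofReal (y ^ r)
      * ENNReal.ofReal (Real.exp (-4 * Real.pi * ξ * y))) * ‖h ξ‖ₑ ^ 2 := by
    refine AEMeasurable.mul (Measurable.aemeasurable ?_) (hh.enorm.pow_const 2)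
    exact Measurable.lintegral_prod_left' (f := fun p : ℝ × ℝ => ENNReal.ofReal (p.1 ^ r)
        * ENNReal.ofReal (Real.exp (-4 * Real.pi * p.2 * p.1))) (by fun_prop)
  filter_upwards [ae_lt_top' hmeas hfin.ne] with ξ hξ hneg
  by_contra hne
  rw [lintegral_rpow_mul_exp_eq_top r (by nlinarith [Real.pi_pos]),
    ENNReal.top_mul (by simpa using hne)] at hξ
  exact hξ.ne rfl

end LaplaceDensity

section PaleyWiener

variable {E : Type*} [NormedAddCommGroup E] [InnerProductSpace ℂ E]

/-- The restriction of `G` to the line `Im z = y` has Fourier transform `e^{-2πyξ} h ξ`, for every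
`y > 0` for which this restriction is square integrable. -/
def IsSpectralDensity [CompleteSpace E] (G : ℂ → E) (h : ℝ → E) : Prop :=
  ∀ y : ℝ, 0 < y → ∀ hy : MemLp (fun x : ℝ => G (x + y * Complex.I)) 2,
    (𝓕 (hy.toLp _) : Lp E 2 (volume : Measure ℝ)) =ᵐ[volume] damp y h

lemma IsSpectralDensity.lintegral_enorm_damp_sq [CompleteSpace E] {G : ℂ → E} {h : ℝ → E}
    (hh : IsSpectralDensity G h) {y : ℝ} (hy0 : 0 < y)
    (hy : MemLp (fun x : ℝ => G (x + y * Complex.I)) 2) :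
    ∫⁻ ξ, ‖damp y h ξ‖ₑ ^ 2 = ∫⁻ x : ℝ, ‖G (x + y * Complex.I)‖ₑ ^ 2 := by
  rw [← eLpNorm_two_sq, ← eLpNorm_two_sq, ← eLpNorm_congr_ae (hh y hy0 hy), eLpNorm_fourier_toLp]

/-- The functions `G`, holomorphic on the upper half-plane, such that `y ^ r ‖G (· + iy)‖²` is
integrable on `(a, ∞)` for every `a > 0`, the norm being that of `L²(ℝ)`. Hardy functions satisfy
this with `r = -2`, and functions in `A_β` with `r = β - 2`. -/
structure IsSquareIntegrableAbove (r : ℝ) (G : ℂ → E) : Prop where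
  differentiableOn : DifferentiableOn ℂ G {z | 0 < z.im}
  lintegral_lt_top : ∀ a > 0, ∫⁻ y in Set.Ioi a, ENNReal.ofReal (y ^ r)
    * ∫⁻ x : ℝ, ‖G (x + y * Complex.I)‖ₑ ^ 2 < ∞

namespace IsSquareIntegrableAbove

variable {r a b c : ℝ} {G : ℂ → E}

lemma continuous_line (hG : IsSquareIntegrableAbove r G) (ha : 0 < a) :
    Continuous fun x : ℝ => G (x + a * Complex.I) :=
  hG.differentiableOn.continuousOn.comp_continuous (by fun_prop) fun x => by simpa using ha

lemma aestronglyMeasurable_strip (hG : IsSquareIntegrableAbove r G) {S : Set ℝ}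
    (hS : MeasurableSet S) (hpos : S ⊆ Set.Ioi 0) :
    AEStronglyMeasurable (fun p : ℝ × ℝ => G (p.1 + p.2 * Complex.I))
      (volume.prod (volume.restrict S)) :=
  BergmanTransform.aestronglyMeasurable_strip hS <|
    hG.differentiableOn.continuousOn.mono fun _ hz => hpos hz

lemma ae_memLp_line (hG : IsSquareIntegrableAbove r G) (ha : 0 < a) :
    ∀ᵐ y : ℝ ∂volume.restrict (Set.Ioi a), MemLp (fun x : ℝ => G (x + y * Complex.I)) 2 := by
  have hmeas : AEMeasurable (fun y : ℝ => ENNReal.ofReal (y ^ r)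
      * ∫⁻ x : ℝ, ‖G (x + y * Complex.I)‖ₑ ^ 2) (volume.restrict (Set.Ioi a)) :=
    (by fun_prop : Measurable fun y : ℝ => ENNReal.ofReal (y ^ r)).aemeasurable.mul
      (((hG.aestronglyMeasurable_strip measurableSet_Ioi
        (Set.Ioi_subset_Ioi ha.le)).enorm.pow_const 2).lintegral_prod_left')
  filter_upwards [ae_lt_top' hmeas (hG.lintegral_lt_top a ha).ne,
    ae_restrict_mem measurableSet_Ioi] with y hy hya
  have hy0 : 0 < y := ha.trans hya
  rw [memLp_two_iff_lintegral (hG.continuous_line hy0).aestronglyMeasurable]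
  refine ENNReal.lt_top_of_mul_ne_top_right hy.ne ?_
  simpa using Real.rpow_pos_of_pos hy0 r

lemma exists_memLp_line (hG : IsSquareIntegrableAbove r G) (hc : 0 < c) :
    ∃ y ∈ Set.Ioo 0 c, MemLp (fun x : ℝ => G (x + y * Complex.I)) 2 := by
  have hIoo : Set.Ioo (c / 2) c ⊆ Set.Ioi (c / 2) := Set.Ioo_subset_Ioi_self
  have : NeBot (ae (volume.restrict (Set.Ioo (c / 2) c))) := by
    rw [ae_neBot, Ne, Measure.restrict_eq_zero, Real.volume_Ioo]
    simpa using hc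
  obtain ⟨y, hy, hmem⟩ := ((ae_restrict_of_ae_restrict_of_subset hIoo
    (hG.ae_memLp_line (half_pos hc))).and (ae_restrict_mem measurableSet_Ioo)).exists
  exact ⟨y, ⟨(half_pos hc).trans hmem.1, hmem.2⟩, hy⟩

lemma memLp_strip (hG : IsSquareIntegrableAbove r G) (ha : 0 < a) :
    MemLp (fun p : ℝ × ℝ => G (p.1 + p.2 * Complex.I)) 2
      (volume.prod (volume.restrict (Set.Ioo a b))) := by
  have hmeas := hG.aestronglyMeasurable_strip (measurableSet_Ioo (a := a) (b := b))
    (Set.Ioo_subset_Ioi_self.trans (Set.Ioi_subset_Ioi ha.le))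
  rw [memLp_two_iff_lintegral hmeas, lintegral_prod_symm _ (hmeas.enorm.pow_const 2)]
  let m : ℝ := min (a ^ r) (b ^ r)
  have hm : ∀ y ∈ Set.Ioo a b, 0 < m ∧ m ≤ y ^ r := fun y hy => by
    have hy0 : 0 < y := ha.trans hy.1
    refine ⟨lt_min (Real.rpow_pos_of_pos ha r) (Real.rpow_pos_of_pos (hy0.trans hy.2) r), ?_⟩
    rcases le_total 0 r with hr | hr
    · exact (min_le_left _ _).trans (Real.rpow_le_rpow ha.le hy.1.le hr)
    · exact (min_le_right _ _).trans (Real.rpow_le_rpow_of_nonpos hy0 hy.2.le hr)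
  rcases (Set.Ioo a b).eq_empty_or_nonempty with hempty | ⟨y, hy⟩
  · simp [hempty]
  refine ENNReal.lt_top_of_mul_ne_top_right (a := ENNReal.ofReal m) (ne_top_of_le_ne_top
    (hG.lintegral_lt_top a ha).ne ?_) (by simpa using (hm y hy).1)
  rw [← lintegral_const_mul' _ _ ENNReal.ofReal_ne_top]
  refine (setLIntegral_mono' measurableSet_Ioo fun y hy => ?_).trans
    (lintegral_mono_set Set.Ioo_subset_Ioi_self)
  gcongr
  exact (hm y hy).2

variable [CompleteSpace E]

lemma damp_fourier_line_ae_eq (hG : IsSquareIntegrableAbove r G) (ha0 : 0 < a) (hb0 : 0 < b)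
    (ha : MemLp (fun x : ℝ => G (x + a * Complex.I)) 2)
    (hb : MemLp (fun x : ℝ => G (x + b * Complex.I)) 2) :
    damp (-a) (𝓕 (ha.toLp _) : Lp E 2 (volume : Measure ℝ))
      =ᵐ[volume] damp (-b) (𝓕 (hb.toLp _) : Lp E 2 (volume : Measure ℝ)) := by
  wlog hab : a ≤ b generalizing a b
  · exact (this hb0 ha0 hb ha (le_of_not_ge hab)).symm
  exact damp_fourier_toLp_line_ae_eq hab
    (hG.differentiableOn.mono fun z hz => ha0.trans_le hz.1) (hG.memLp_strip ha0) ha hb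

lemma exists_isSpectralDensity (hG : IsSquareIntegrableAbove r G) :
    ∃ h : ℝ → E, IsSpectralDensity G h := by
  obtain ⟨a, ha, hline⟩ := hG.exists_memLp_line one_pos
  exact ⟨damp (-a) (𝓕 (hline.toLp _) : Lp E 2 (volume : Measure ℝ)), fun _ hy0 hy =>
    damp_ae_eq_iff.1 (hG.damp_fourier_line_ae_eq hy0 ha.1 hy hline)⟩

lemma ae_eq_zero_of_isSpectralDensity (hG : IsSquareIntegrableAbove r G) {h : ℝ → E}
    (hh : IsSpectralDensity G h) :
    ∀ᵐ ξ : ℝ, ξ < 0 → h ξ = 0 := by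
  obtain ⟨a, ha, hline⟩ := hG.exists_memLp_line one_pos
  refine ae_eq_zero_of_lintegral_damp_lt_top (r := r) (aestronglyMeasurable_of_damp
    ((Lp.aestronglyMeasurable _).congr (hh a ha.1 hline))) ?_
  refine (lintegral_congr_ae ?_).trans_lt (hG.lintegral_lt_top 1 one_pos)
  filter_upwards [hG.ae_memLp_line one_pos, ae_restrict_mem measurableSet_Ioi] with y hy hy1
  rw [hh.lintegral_enorm_damp_sq (one_pos.trans hy1) hy]

lemma exists_isLaplaceDensity (hG : IsSquareIntegrableAbove r G) :
    ∃ h : ℝ → E, IsLaplaceDensity h ∧ IsSpectralDensity G h := by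
  obtain ⟨k, hk⟩ := hG.exists_isSpectralDensity
  let h : ℝ → E := (Set.Ioi 0).indicator k
  have hkh : k =ᵐ[volume] h := by
    filter_upwards [hG.ae_eq_zero_of_isSpectralDensity hk, Measure.ae_ne volume (0 : ℝ)]
      with ξ hneg hne
    rcases hne.lt_or_gt with hξ | hξ
    · exact (hneg hξ).trans (Set.indicator_of_notMem (Set.notMem_Ioi.2 hξ.le) k).symm
    · exact (Set.indicator_of_mem (Set.mem_Ioi.2 hξ) k).symm
  have hh : IsSpectralDensity G h := fun y hy0 hy => (hk y hy0 hy).trans (damp_congr_ae hkh y)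
  have h0 : ∀ ξ ≤ 0, h ξ = 0 := fun ξ hξ => Set.indicator_of_notMem (Set.notMem_Ioi.2 hξ) k
  refine ⟨h, ⟨h0, fun s hs => ?_⟩, hh⟩
  obtain ⟨y, hy, hline⟩ := hG.exists_memLp_line hs
  exact memLp_damp_of_le h0 hy.2.le ((Lp.memLp _).ae_eq (hh y hy.1 hline))

lemma line_eq_fourierLaplace (hG : IsSquareIntegrableAbove r G) {h : ℝ → E}
    (hh : IsLaplaceDensity h) (hGh : IsSpectralDensity G h) (ha0 : 0 < a)
    (ha : MemLp (fun x : ℝ => G (x + a * Complex.I)) 2) (x : ℝ) :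
    G (x + a * Complex.I) = fourierLaplace h (x + a * Complex.I) := by
  have h1 := hh.integrable_damp ha0
  have h2 := hh.memLp_damp a ha0
  have hfourier : 𝓕 (ha.toLp _) = h2.toLp (damp a h) :=
    Lp.ext ((hGh a ha0 ha).trans h2.coeFn_toLp.symm)
  have hLp : ha.toLp _ = (memLp_fourierLaplace_line h1 h2).toLp _ := by
    rw [toLp_fourierLaplace_line h1 h2, ← hfourier, FourierTransform.fourierInv_fourier_eq]
  have hcont : Continuous fun x : ℝ => fourierLaplace h (x + a * Complex.I) :=
    hh.differentiableOn_fourierLaplace.continuousOn.comp_continuous (by fun_prop)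
      fun x => by simpa using ha0
  exact congrFun (((hG.continuous_line ha0).ae_eq_iff_eq volume hcont).1
    ((MemLp.toLp_eq_toLp_iff _ _).1 hLp)) x

theorem exists_eq_fourierLaplace (hG : IsSquareIntegrableAbove r G) :
    ∃ h : ℝ → E, IsLaplaceDensity h ∧ Set.EqOn G (fourierLaplace h) {z | 0 < z.im} := by
  obtain ⟨h, hh, hGh⟩ := hG.exists_isLaplaceDensity
  refine ⟨h, hh, fun z (hz : 0 < z.im) => ?_⟩
  have hvert : ∀ {F : ℂ → E}, DifferentiableOn ℂ F {z | 0 < z.im} →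
      ContinuousOn (fun y : ℝ => F (z.re + y * Complex.I)) (Set.Ioi (z.im / 2)) := fun hF =>
    hF.continuousOn.comp (by fun_prop) fun y hy => by simpa using (half_pos hz).trans hy
  have hae : (fun y : ℝ => G (z.re + y * Complex.I))
      =ᵐ[volume.restrict (Set.Ioi (z.im / 2))]
        fun y => fourierLaplace h (z.re + y * Complex.I) := by
    filter_upwards [hG.ae_memLp_line (half_pos hz), ae_restrict_mem measurableSet_Ioi]
      with y hy hyz
    have hy0 : 0 < y := (half_pos hz).trans hyz
    exact hG.line_eq_fourierLaplace hh hGh hy0 hy z.re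
  simpa using Measure.eqOn_open_of_ae_eq hae isOpen_Ioi (hvert hG.differentiableOn)
    (hvert hh.differentiableOn_fourierLaplace) (half_lt_self hz)

end IsSquareIntegrableAbove

end PaleyWiener

section UpperHalfPlane

variable {h : ℝ → ℂ}

lemma slice_eq_comp_ofComplex (f : ℍ → ℂ) {y : ℝ} (hy : 0 < y) :
    slice f ⟨y, hy⟩ = fun x : ℝ => (f ∘ UpperHalfPlane.ofComplex) (x + y * Complex.I) := by
  ext x
  rw [Function.comp_apply, UpperHalfPlane.ofComplex_apply_of_im_pos (by simpa using hy)]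
  rfl

lemma IsLaplaceDensity.mdifferentiable_fourierLaplace (hh : IsLaplaceDensity h) :
    MDifferentiable 𝓘(ℂ) 𝓘(ℂ) fun z : ℍ => fourierLaplace h z :=
  UpperHalfPlane.mdifferentiable_iff.2 <| hh.differentiableOn_fourierLaplace.congr fun z hz => by
    rw [Function.comp_apply, UpperHalfPlane.ofComplex_apply_of_im_pos hz]

lemma IsSquareIntegrableAbove.exists_apply_eq_fourierLaplace {f : ℍ → ℂ} {r : ℝ}
    (hf : IsSquareIntegrableAbove r (f ∘ UpperHalfPlane.ofComplex)) :
    ∃ h : ℝ → ℂ, IsLaplaceDensity h ∧ ∀ z : ℍ, f z = fourierLaplace h z := by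
  obtain ⟨h, hh, heq⟩ := hf.exists_eq_fourierLaplace
  exact ⟨h, hh, fun z => by simpa using heq z.im_pos⟩

end UpperHalfPlane

/-! ### The Hardy space -/

section Hardy

variable {h k : ℝ → ℂ}

lemma IsLaplaceDensity.hardyENorm_fourierLaplace (hh : IsLaplaceDensity h) :
    hardyENorm (fun z : ℍ => fourierLaplace h z) = eLpNorm h 2 volume := by
  have hslice : ∀ s : Set.Ioi (0 : ℝ), eLpNorm (slice (fun z : ℍ => fourierLaplace h z) s) 2 volume
      = eLpNorm (damp s h) 2 volume := fun s =>
    eLpNorm_fourierLaplace_line (hh.integrable_damp s.2) (hh.memLp_damp s s.2)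
  simp only [hardyENorm, hslice]
  refine le_antisymm (iSup_le fun s => ?_) ?_
  · simpa using eLpNorm_mono (p := 2) (norm_damp_le_of_le hh.eq_zero (le_of_lt s.2))
  · let s (n : ℕ) : Set.Ioi (0 : ℝ) := ⟨1 / ((n : ℝ) + 1), by
      simpa using Nat.cast_add_one_pos n⟩
    have hfatou : eLpNorm h 2 volume ≤ liminf (fun n => eLpNorm (damp (s n) h) 2 volume) atTop :=
      Lp.eLpNorm_lim_le_liminf_eLpNorm
        (fun n => aestronglyMeasurable_damp hh.aestronglyMeasurable (s n)) h
        (Eventually.of_forall fun ξ => tendsto_damp tendsto_one_div_add_atTop_nhds_zero_nat h ξ)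
    exact hfatou.trans <| liminf_le_of_le (by isBoundedDefault) fun b hb =>
      let ⟨n, hn⟩ := hb.exists
      hn.trans (le_iSup (fun s : Set.Ioi (0 : ℝ) => eLpNorm (damp s h) 2 volume) (s n))

lemma HardySpace.isSquareIntegrableAbove (f : HardySpace) :
    IsSquareIntegrableAbove (-2) ((f : ℍ → ℂ) ∘ UpperHalfPlane.ofComplex) where
  differentiableOn := UpperHalfPlane.mdifferentiable_iff.1 f.2.1
  lintegral_lt_top a ha := by
    calc ∫⁻ y in Set.Ioi a, ENNReal.ofReal (y ^ (-2 : ℝ))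
          * ∫⁻ x : ℝ, ‖((f : ℍ → ℂ) ∘ UpperHalfPlane.ofComplex) (x + y * Complex.I)‖ₑ ^ 2
        ≤ ∫⁻ y in Set.Ioi a, ENNReal.ofReal (y ^ (-2 : ℝ)) * hardyENorm f ^ 2 := by
          refine setLIntegral_mono' measurableSet_Ioi fun y hy => ?_
          rw [← eLpNorm_two_sq, ← slice_eq_comp_ofComplex _ (ha.trans hy)]
          gcongr
          exact le_iSup (fun s => eLpNorm (slice f s) 2 volume) _
      _ = (∫⁻ y in Set.Ioi a, ENNReal.ofReal (y ^ (-2 : ℝ))) * hardyENorm f ^ 2 :=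
          lintegral_mul_const' _ _ (ENNReal.pow_ne_top f.2.2.ne)
      _ < ∞ := ENNReal.mul_lt_top
          (integrableOn_Ioi_rpow_of_lt (by norm_num) ha).lintegral_lt_top
          (ENNReal.pow_lt_top f.2.2)

/-- `h` is an `L²` function supported on the positive half-line whose Fourier–Laplace transform is
`f`. Up to the normalization of the Fourier transform, `h` is the Fourier transform of the boundary
function of `f`. -/
structure HasHardyDensity (f : ℍ → ℂ) (h : ℝ → ℂ) : Prop where
  eq_zero : ∀ ξ ≤ 0, h ξ = 0
  memLp : MemLp h 2 volume
  apply_eq : ∀ z : ℍ, f z = fourierLaplace h z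

theorem HardySpace.exists_hasHardyDensity (f : HardySpace) : ∃ h, HasHardyDensity f h := by
  obtain ⟨h, hh, hf⟩ := (HardySpace.isSquareIntegrableAbove f).exists_apply_eq_fourierLaplace
  refine ⟨h, hh.eq_zero, ⟨hh.aestronglyMeasurable, ?_⟩, hf⟩
  rw [← hh.hardyENorm_fourierLaplace, ← funext hf]
  exact f.2.2

namespace HasHardyDensity

variable {f g : ℍ → ℂ}

lemma isLaplaceDensity (hf : HasHardyDensity f h) : IsLaplaceDensity h :=
  .of_memLp hf.eq_zero hf.memLp

lemma hardyENorm_eq (hf : HasHardyDensity f h) : hardyENorm f = eLpNorm h 2 volume := by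
  rw [← hf.isLaplaceDensity.hardyENorm_fourierLaplace, ← funext hf.apply_eq]

lemma mem_hardySpace (hf : HasHardyDensity f h) : f ∈ HardySpace :=
  ⟨funext hf.apply_eq ▸ hf.isLaplaceDensity.mdifferentiable_fourierLaplace,
    hf.hardyENorm_eq ▸ hf.memLp.2⟩

lemma add (hf : HasHardyDensity f h) (hg : HasHardyDensity g k) :
    HasHardyDensity (f + g) (h + k) where
  eq_zero ξ hξ := by simp [hf.eq_zero ξ hξ, hg.eq_zero ξ hξ]
  memLp := hf.memLp.add hg.memLp
  apply_eq z := by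
    rw [Pi.add_apply, hf.apply_eq, hg.apply_eq,
      fourierLaplace_add (hf.isLaplaceDensity.integrable_damp z.im_pos)
        (hg.isLaplaceDensity.integrable_damp z.im_pos)]

lemma const_smul (c : ℂ) (hf : HasHardyDensity f h) : HasHardyDensity (c • f) (c • h) where
  eq_zero ξ hξ := by simp [hf.eq_zero ξ hξ]
  memLp := hf.memLp.const_smul c
  apply_eq z := by rw [Pi.smul_apply, hf.apply_eq, fourierLaplace_const_smul]

end HasHardyDensity

instance : heightToZero.IsCountablyGenerated :=
  inferInstanceAs (comap _ _).IsCountablyGenerated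

instance : heightToZero.NeBot :=
  mem_closure_iff_comap_neBot.1 (by simp)

variable {f : HardySpace}

lemma sliceL2_eq_fourierInv (hf : HasHardyDensity f h) (s : Set.Ioi (0 : ℝ)) :
    sliceL2 f s = 𝓕⁻ ((hf.isLaplaceDensity.memLp_damp s s.2).toLp (damp s h)) := by
  rw [← toLp_fourierLaplace_line (hf.isLaplaceDensity.integrable_damp s.2)]
  exact MemLp.toLp_congr _ _ (Eventually.of_forall fun x => hf.apply_eq (point x s))

lemma tendsto_sliceL2 (hf : HasHardyDensity f h) :
    Tendsto (sliceL2 f) heightToZero (𝓝 (𝓕⁻ (hf.memLp.toLp h))) := by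
  refine Tendsto.congr (fun s => (sliceL2_eq_fourierInv hf s).symm) <|
    ((Lp.fourierTransformₗᵢ ℝ ℂ).symm.continuous.tendsto _).comp ?_
  refine (Lp.tendsto_Lp_iff_tendsto_eLpNorm'' _
    (fun s : Set.Ioi (0 : ℝ) => hf.isLaplaceDensity.memLp_damp s s.2) h hf.memLp).2 ?_
  refine tendsto_eLpNorm_sub_of_dominated (g := fun ξ => ‖h ξ‖ + ‖h ξ‖) two_ne_zero
    ENNReal.ofNat_ne_top
    (Eventually.of_forall fun s => aestronglyMeasurable_damp hf.memLp.1 s) hf.memLp.1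
    (hf.memLp.norm.add hf.memLp.norm)
    (Eventually.of_forall fun s => Eventually.of_forall fun ξ => ?_)
    (Eventually.of_forall fun ξ => tendsto_damp tendsto_comap h ξ)
  refine (norm_sub_le _ _).trans (add_le_add_left ?_ _)
  simpa using norm_damp_le_of_le hf.eq_zero (le_of_lt s.2) ξ

lemma boundary_eq_fourierInv (hf : HasHardyDensity f h) : boundary f = 𝓕⁻ (hf.memLp.toLp h) :=
  (tendsto_sliceL2 hf).limUnder_eq

theorem tendsto_boundary (f : HardySpace) : Tendsto (sliceL2 f) heightToZero (𝓝 (boundary f)) := by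
  obtain ⟨h, hf⟩ := HardySpace.exists_hasHardyDensity f
  exact boundary_eq_fourierInv hf ▸ tendsto_sliceL2 hf

lemma unitaryFourier_boundary_ae_eq (hf : HasHardyDensity f h) :
    ∀ᵐ t : ℝ, unitaryFourier (boundary f) t
      = ((Real.sqrt (2 * Real.pi))⁻¹ : ℝ) * h (t / (2 * Real.pi)) := by
  have hfourier : (𝓕 (boundary f) : Lp ℂ 2 (volume : Measure ℝ)) =ᵐ[volume] h := by
    rw [boundary_eq_fourierInv hf, FourierTransform.fourier_fourierInv_eq]
    exact hf.memLp.coeFn_toLp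
  have hscale : Measure.QuasiMeasurePreserving (fun t : ℝ => t / (2 * Real.pi)) volume volume := by
    refine ⟨by fun_prop, ?_⟩
    simp only [div_eq_mul_inv]
    rw [Real.map_volume_mul_right (inv_ne_zero Real.two_pi_pos.ne')]
    exact Measure.smul_absolutelyContinuous
  filter_upwards [hscale.ae hfourier] with t ht
  rw [unitaryFourier, ht]

end Hardy

/-! ### The Bergman space -/

section Bergman

lemma lintegral_comap_coe (φ : ℂ → ℝ≥0∞) :
    ∫⁻ z : ℍ, φ z ∂(Measure.comap UpperHalfPlane.coe volume)
      = ∫⁻ p : ℝ × ℝ, φ (p.1 + p.2 * Complex.I) ∂(volume.prod (volume.restrict (Set.Ioi 0))) := by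
  have hrange : Set.range UpperHalfPlane.coe
      = Complex.measurableEquivRealProd ⁻¹' (Set.univ ×ˢ Set.Ioi 0) := by
    ext z
    simp
  have hprod : (volume : Measure ℝ).prod (volume.restrict (Set.Ioi (0 : ℝ)))
      = (volume : Measure (ℝ × ℝ)).restrict (Set.univ ×ˢ Set.Ioi 0) := by
    rw [Measure.volume_eq_prod, ← Measure.prod_restrict, Measure.restrict_univ]
  rw [← UpperHalfPlane.measurableEmbedding_coe.lintegral_map,
    UpperHalfPlane.measurableEmbedding_coe.map_comap, hrange, hprod,
    ← Complex.volume_preserving_equiv_real_prod.setLIntegral_comp_preimage_emb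
      Complex.measurableEquivRealProd.measurableEmbedding]
  simp

lemma lintegral_bergmanMeasure (β : ℝ) {φ : ℂ → ℝ≥0∞}
    (hφ : AEMeasurable (fun p : ℝ × ℝ => φ (p.1 + p.2 * Complex.I))
      (volume.prod (volume.restrict (Set.Ioi 0)))) :
    ∫⁻ z : ℍ, φ z ∂(bergmanMeasure β) = ∫⁻ y in Set.Ioi (0 : ℝ), ENNReal.ofReal (y ^ (β - 2))
      * ∫⁻ x : ℝ, φ (x + y * Complex.I) := by
  have him : Measurable fun z : ℍ => z.im := UpperHalfPlane.continuous_im.measurable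
  have hweight : Measurable fun p : ℝ × ℝ =>
    ENNReal.ofReal ((p.1 + p.2 * Complex.I : ℂ).im ^ (β - 2)) := by fun_prop
  calc ∫⁻ z : ℍ, φ z ∂(bergmanMeasure β)
      = ∫⁻ z : ℍ, ENNReal.ofReal ((z : ℂ).im ^ (β - 2)) * φ z
          ∂(Measure.comap UpperHalfPlane.coe volume) :=
        lintegral_withDensity_eq_lintegral_mul_non_measurable _ (him.pow_const _).ennreal_ofReal
          (Eventually.of_forall fun _ => ENNReal.ofReal_lt_top) _
    _ = ∫⁻ y in Set.Ioi (0 : ℝ), ∫⁻ x : ℝ, ENNReal.ofReal ((x + y * Complex.I : ℂ).im ^ (β - 2))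
          * φ (x + y * Complex.I) := by
        rw [lintegral_comap_coe fun w => ENNReal.ofReal (w.im ^ (β - 2)) * φ w]
        exact lintegral_prod_symm _ (hweight.aemeasurable.mul hφ)
    _ = _ := by
        simp only [← lintegral_const_mul' _ _ ENNReal.ofReal_ne_top]
        simp

lemma lintegral_enorm_sq_bergmanMeasure {E : Type*} [NormedAddCommGroup E] (β : ℝ) {G : ℂ → E}
    (hG : ContinuousOn G {z | 0 < z.im}) :
    ∫⁻ z : ℍ, ‖G z‖ₑ ^ 2 ∂(bergmanMeasure β) = ∫⁻ y in Set.Ioi (0 : ℝ),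
      ENNReal.ofReal (y ^ (β - 2)) * ∫⁻ x : ℝ, ‖G (x + y * Complex.I)‖ₑ ^ 2 :=
  lintegral_bergmanMeasure β (φ := fun z => ‖G z‖ₑ ^ 2)
    ((aestronglyMeasurable_strip measurableSet_Ioi hG).enorm.pow_const 2)

lemma lintegral_rpow_mul_exp {r c : ℝ} (hr : -1 < r) (hc : 0 < c) :
    ∫⁻ y in Set.Ioi (0 : ℝ), ENNReal.ofReal (y ^ r) * ENNReal.ofReal (Real.exp (-c * y))
      = ENNReal.ofReal (c ^ (-(r + 1)) * Real.Gamma (r + 1)) := by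
  have hint : ∫ y in Set.Ioi (0 : ℝ), y ^ r * Real.exp (-c * y)
      = c ^ (-(r + 1)) * Real.Gamma (r + 1) := by
    have hgamma := Real.integral_rpow_mul_exp_neg_mul_Ioi (a := r + 1) (by linarith) hc
    rw [add_sub_cancel_right, one_div, Real.inv_rpow hc.le, ← Real.rpow_neg hc.le] at hgamma
    simpa only [neg_mul] using hgamma
  have hpos : 0 < c ^ (-(r + 1)) * Real.Gamma (r + 1) :=
    mul_pos (Real.rpow_pos_of_pos hc _) (Real.Gamma_pos_of_pos (by linarith))
  rw [← hint, ofReal_integral_eq_lintegral_ofReal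
    (Integrable.of_integral_ne_zero (hint ▸ hpos.ne'))]
  · refine setLIntegral_congr_fun measurableSet_Ioi fun y (hy : 0 < y) => ?_
    rw [ENNReal.ofReal_mul (Real.rpow_nonneg hy.le _)]
  · filter_upwards [ae_restrict_mem measurableSet_Ioi] with y (hy : 0 < y)
    exact mul_nonneg (Real.rpow_nonneg hy.le _) (Real.exp_pos _).le

lemma IsLaplaceDensity.lintegral_bergmanMeasure {E : Type*} [NormedAddCommGroup E]
    [InnerProductSpace ℂ E] [CompleteSpace E] {g : ℝ → E} (hg : IsLaplaceDensity g) {β : ℝ}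
    (hβ : 1 < β) :
    ∫⁻ z : ℍ, ‖fourierLaplace g z‖ₑ ^ 2 ∂(bergmanMeasure β)
      = ∫⁻ ξ : ℝ, ENNReal.ofReal ((4 * Real.pi * ξ) ^ (1 - β) * Real.Gamma (β - 1))
          * ‖g ξ‖ₑ ^ 2 := by
  calc ∫⁻ z : ℍ, ‖fourierLaplace g z‖ₑ ^ 2 ∂(bergmanMeasure β)
      = ∫⁻ y in Set.Ioi (0 : ℝ), ENNReal.ofReal (y ^ (β - 2)) * ∫⁻ ξ, ‖damp y g ξ‖ₑ ^ 2 := by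
        rw [lintegral_enorm_sq_bergmanMeasure β hg.differentiableOn_fourierLaplace.continuousOn]
        refine setLIntegral_congr_fun measurableSet_Ioi fun y (hy : 0 < y) => ?_
        simp only [← eLpNorm_two_sq,
          eLpNorm_fourierLaplace_line (hg.integrable_damp hy) (hg.memLp_damp y hy)]
    _ = ∫⁻ ξ, (∫⁻ y in Set.Ioi (0 : ℝ), ENNReal.ofReal (y ^ (β - 2))
          * ENNReal.ofReal (Real.exp (-4 * Real.pi * ξ * y))) * ‖g ξ‖ₑ ^ 2 :=
        lintegral_rpow_mul_lintegral_damp hg.aestronglyMeasurable _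
    _ = _ := by
        refine lintegral_congr fun ξ => ?_
        rcases le_or_gt ξ 0 with hξ | hξ
        · simp [hg.eq_zero ξ hξ]
        have hgamma := lintegral_rpow_mul_exp (r := β - 2) (c := 4 * Real.pi * ξ) (by linarith)
          (by positivity)
        rw [show -(β - 2 + 1) = 1 - β by ring, show β - 2 + 1 = β - 1 by ring] at hgamma
        simp only [← hgamma, neg_mul]

lemma BergmanSpace.isSquareIntegrableAbove {β : ℝ} (F : BergmanSpace β) :
    IsSquareIntegrableAbove (β - 2) ((F : ℍ → ℂ) ∘ UpperHalfPlane.ofComplex) where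
  differentiableOn := UpperHalfPlane.mdifferentiable_iff.1 F.2.1
  lintegral_lt_top a ha := by
    have hdiff := UpperHalfPlane.mdifferentiable_iff.1 F.2.1
    refine (lintegral_mono_set (Set.Ioi_subset_Ioi ha.le)).trans_lt ?_
    rw [← lintegral_enorm_sq_bergmanMeasure β hdiff.continuousOn, ← eLpNorm_two_sq]
    simpa only [Function.comp_apply, UpperHalfPlane.ofComplex_apply] using
      ENNReal.pow_lt_top F.2.2.2

end Bergman

/-! ### The Bergman transform -/

section BergmanIsometry

variable {α : ℝ}

/-- The factor by which `Ber α` multiplies densities: the weight `t ^ α` at `t = 2πξ`, together with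
the constant coming from the two normalizations of the Fourier transform. -/
def berWeight (α ξ : ℝ) : ℝ := Real.sqrt (2 * Real.pi) * (2 * Real.pi * ξ) ^ α

lemma berWeight_pos (α : ℝ) {ξ : ℝ} (hξ : 0 < ξ) : 0 < berWeight α ξ := by
  unfold berWeight
  positivity

lemma measurable_berWeight (α : ℝ) : Measurable (berWeight α) := by
  unfold berWeight
  fun_prop

lemma rpow_le_mul_exp (hα : 0 < α) {ε x : ℝ} (hε : 0 < ε) (hx : 0 ≤ x) :
    x ^ α ≤ (α / ε) ^ α * Real.exp (ε * x) := by
  have hle : ε * x / α ≤ Real.exp (ε * x / α) := by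
    linarith [Real.add_one_le_exp (ε * x / α)]
  calc x ^ α = (α / ε) ^ α * (ε * x / α) ^ α := by
        rw [← Real.mul_rpow (by positivity) (by positivity)]
        congr 1
        field_simp
    _ ≤ (α / ε) ^ α * Real.exp (ε * x / α) ^ α := by gcongr
    _ = (α / ε) ^ α * Real.exp (ε * x) := by rw [← Real.exp_mul, div_mul_cancel₀ _ hα.ne']

lemma IsLaplaceDensity.berWeight_smul {E : Type*} [NormedAddCommGroup E] [NormedSpace ℝ E]
    {h : ℝ → E} (hα : 0 < α) (hh : IsLaplaceDensity h) : IsLaplaceDensity (berWeight α • h) := by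
  refine hh.smul_of_abs_le_mul_exp (measurable_berWeight α).aestronglyMeasurable fun ε hε =>
    ⟨Real.sqrt (2 * Real.pi) * (α / (ε / (2 * Real.pi))) ^ α, fun ξ hξ => ?_⟩
  have hexp : ε / (2 * Real.pi) * (2 * Real.pi * ξ) = ε * ξ := by field_simp
  rw [abs_of_pos (berWeight_pos α hξ), berWeight, mul_assoc (Real.sqrt _), ← hexp]
  gcongr
  exact rpow_le_mul_exp hα (div_pos hε Real.two_pi_pos) (by positivity)

variable {f : HardySpace} {h : ℝ → ℂ}

lemma berIntegrand_ae_eq (α : ℝ) (hf : HasHardyDensity f h) (z : ℍ) :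
    berIntegrand α f z =ᵐ[volume] fun t : ℝ => (2 * Real.pi)⁻¹ •
      (Complex.exp (2 * Real.pi * Complex.I * z * (t / (2 * Real.pi) : ℝ))
        • (berWeight α • h) (t / (2 * Real.pi))) := by
  filter_upwards [unitaryFourier_boundary_ae_eq hf] with t ht
  have hexp : (2 * Real.pi * Complex.I * z * (t / (2 * Real.pi) : ℝ) : ℂ) = Complex.I * z * t := by
    push_cast
    field_simp
  have hscale : 2 * Real.pi * (t / (2 * Real.pi)) = t := by field_simp
  rw [berIntegrand, ht, hexp, Pi.smul_apply', berWeight, hscale, ← Real.sqrt_div_self]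
  simp only [Complex.real_smul, smul_eq_mul]
  push_cast
  ring

lemma integrableOn_berIntegrand (hα : 0 < α) (f : HardySpace) (z : ℍ) :
    IntegrableOn (berIntegrand α f z) (Set.Ioi (0 : ℝ)) := by
  obtain ⟨h, hf⟩ := HardySpace.exists_hasHardyDensity f
  have hint := integrable_exp_smul
    ((hf.isLaplaceDensity.berWeight_smul hα).integrable_damp z.im_pos)
  exact (Integrable.congr ((hint.comp_div Real.two_pi_pos.ne').smul (2 * Real.pi)⁻¹)
    (berIntegrand_ae_eq α hf z).symm).integrableOn

lemma ber_eq_fourierLaplace (α : ℝ) (hf : HasHardyDensity f h) (z : ℍ) :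
    Ber α f z = fourierLaplace (berWeight α • h) z := by
  let k (ξ : ℝ) : ℂ := Complex.exp (2 * Real.pi * Complex.I * z * ξ) • (berWeight α • h) ξ
  have hsupp : ∀ t ∉ Set.Ioi (0 : ℝ), k (t / (2 * Real.pi)) = 0 := fun t ht => by
    simp [k, hf.eq_zero _ (div_nonpos_of_nonpos_of_nonneg (not_lt.1 ht) Real.two_pi_pos.le)]
  calc Ber α f z = ∫ t in Set.Ioi (0 : ℝ), (2 * Real.pi)⁻¹ • k (t / (2 * Real.pi)) :=
        integral_congr_ae (ae_restrict_of_ae (berIntegrand_ae_eq α hf z))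
    _ = (2 * Real.pi)⁻¹ • ∫ t, k (t / (2 * Real.pi)) := by
        rw [integral_smul, setIntegral_eq_integral_of_forall_compl_eq_zero hsupp]
    _ = fourierLaplace (berWeight α • h) z := by
        rw [Measure.integral_comp_div, abs_of_pos Real.two_pi_pos,
          inv_smul_smul₀ Real.two_pi_pos.ne', fourierLaplace]

/-- The constant `K_α` by which `Ber α` multiplies squared norms. -/
def berConst (α : ℝ) : ℝ := 2 * Real.pi * Real.Gamma (2 * α) / 4 ^ α

lemma berConst_pos (hα : 0 < α) : 0 < berConst α :=
  div_pos (mul_pos Real.two_pi_pos (Real.Gamma_pos_of_pos (mul_pos two_pos hα)))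
    (Real.rpow_pos_of_pos four_pos _)

lemma rpow_mul_Gamma_mul_berWeight_sq (α : ℝ) {ξ : ℝ} (hξ : 0 < ξ) :
    (4 * Real.pi * ξ) ^ (-(2 * α)) * Real.Gamma (2 * α) * berWeight α ξ ^ 2 = berConst α := by
  have hx : 0 < 2 * Real.pi * ξ := mul_pos Real.two_pi_pos hξ
  have hsq : ((2 * Real.pi * ξ) ^ α) ^ 2 = (2 * Real.pi * ξ) ^ (2 * α) := by
    rw [← Real.rpow_mul_natCast hx.le, mul_comm α, Nat.cast_two]
  have hratio : (4 * Real.pi * ξ) ^ (2 * α) = 4 ^ α * (2 * Real.pi * ξ) ^ (2 * α) := by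
    rw [show 4 * Real.pi * ξ = 2 * (2 * Real.pi * ξ) by ring, Real.mul_rpow two_pos.le hx.le,
      Real.rpow_mul two_pos.le]
    norm_num
  rw [berWeight, mul_pow, Real.sq_sqrt Real.two_pi_pos.le, hsq, Real.rpow_neg (by positivity),
    hratio, berConst]
  have hne := (Real.rpow_pos_of_pos hx (2 * α)).ne'
  field_simp

lemma lintegral_bergmanMeasure_berWeight_smul {E : Type*} [NormedAddCommGroup E]
    [InnerProductSpace ℂ E] [CompleteSpace E] {h : ℝ → E} (hα : 0 < α) (h0 : ∀ ξ ≤ 0, h ξ = 0)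
    (hh : IsLaplaceDensity (berWeight α • h)) :
    ∫⁻ z : ℍ, ‖fourierLaplace (berWeight α • h) z‖ₑ ^ 2 ∂(bergmanMeasure (2 * α + 1))
      = ENNReal.ofReal (berConst α) * ∫⁻ ξ, ‖h ξ‖ₑ ^ 2 := by
  rw [hh.lintegral_bergmanMeasure (by linarith), ← lintegral_const_mul' _ _ ENNReal.ofReal_ne_top]
  refine lintegral_congr fun ξ => ?_
  rcases le_or_gt ξ 0 with hξ | hξ
  · simp [h0 ξ hξ]
  have hw := berWeight_pos α hξ
  rw [show 1 - (2 * α + 1) = -(2 * α) by ring, add_sub_cancel_right, Pi.smul_apply', enorm_smul,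
    Real.enorm_of_nonneg hw.le, mul_pow, ← mul_assoc, ← ENNReal.ofReal_pow hw.le,
    ← ENNReal.ofReal_mul' (by positivity), rpow_mul_Gamma_mul_berWeight_sq α hξ]

lemma eLpNorm_bergmanMeasure_berWeight_smul {E : Type*} [NormedAddCommGroup E]
    [InnerProductSpace ℂ E] [CompleteSpace E] {h : ℝ → E} (hα : 0 < α) (h0 : ∀ ξ ≤ 0, h ξ = 0)
    (hh : IsLaplaceDensity (berWeight α • h)) :
    eLpNorm (fun z : ℍ => fourierLaplace (berWeight α • h) z) 2 (bergmanMeasure (2 * α + 1))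
      = ENNReal.ofReal (Real.sqrt (berConst α)) * eLpNorm h 2 volume := by
  refine (ENNReal.pow_right_strictMono two_ne_zero).injective ?_
  simp only [mul_pow, eLpNorm_two_sq, lintegral_bergmanMeasure_berWeight_smul hα h0 hh,
    ← ENNReal.ofReal_pow (Real.sqrt_nonneg _), Real.sq_sqrt (berConst_pos hα).le]

lemma eLpNorm_ber (hα : 0 < α) (f : HardySpace) :
    eLpNorm (Ber α f) 2 (bergmanMeasure (2 * α + 1))
      = ENNReal.ofReal (Real.sqrt (berConst α)) * hardyENorm f := by
  obtain ⟨h, hf⟩ := HardySpace.exists_hasHardyDensity f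
  rw [funext (ber_eq_fourierLaplace α hf), hf.hardyENorm_eq, eLpNorm_bergmanMeasure_berWeight_smul
    hα hf.eq_zero (hf.isLaplaceDensity.berWeight_smul hα)]

lemma mdifferentiable_ber (hα : 0 < α) (f : HardySpace) : MDifferentiable 𝓘(ℂ) 𝓘(ℂ) (Ber α f) := by
  obtain ⟨h, hf⟩ := HardySpace.exists_hasHardyDensity f
  rw [funext (ber_eq_fourierLaplace α hf)]
  exact (hf.isLaplaceDensity.berWeight_smul hα).mdifferentiable_fourierLaplace

lemma ber_mem_bergmanSpace (hα : 0 < α) (f : HardySpace) : Ber α f ∈ BergmanSpace (2 * α + 1) :=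
  ⟨mdifferentiable_ber hα f, (mdifferentiable_ber hα f).continuous.aestronglyMeasurable,
    eLpNorm_ber hα f ▸ ENNReal.mul_lt_top ENNReal.ofReal_lt_top f.2.2⟩

lemma ber_add (hα : 0 < α) (f g : HardySpace) : Ber α (f + g) = Ber α f + Ber α g := by
  obtain ⟨h, hf⟩ := HardySpace.exists_hasHardyDensity f
  obtain ⟨k, hg⟩ := HardySpace.exists_hasHardyDensity g
  ext z
  rw [Pi.add_apply, ber_eq_fourierLaplace α hf, ber_eq_fourierLaplace α hg,
    ber_eq_fourierLaplace α (hf.add hg), smul_add,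
    fourierLaplace_add ((hf.isLaplaceDensity.berWeight_smul hα).integrable_damp z.im_pos)
      ((hg.isLaplaceDensity.berWeight_smul hα).integrable_damp z.im_pos)]

lemma ber_const_smul (α : ℝ) (c : ℂ) (f : HardySpace) : Ber α (c • f) = c • Ber α f := by
  obtain ⟨h, hf⟩ := HardySpace.exists_hasHardyDensity f
  have hcomm : berWeight α • c • h = c • berWeight α • h := by
    ext ξ
    exact smul_comm (berWeight α ξ) c (h ξ)
  ext z
  rw [Pi.smul_apply, ber_eq_fourierLaplace α hf, ber_eq_fourierLaplace α (hf.const_smul c), hcomm,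
    fourierLaplace_const_smul]

/-- The Bergman transform as a linear map from the Hardy space to the Bergman space. -/
def berLinearMap (hα : 0 < α) : HardySpace →ₗ[ℂ] BergmanSpace (2 * α + 1) where
  toFun f := ⟨Ber α f, ber_mem_bergmanSpace hα f⟩
  map_add' f g := Subtype.ext (ber_add hα f g)
  map_smul' c f := Subtype.ext (ber_const_smul α c f)

lemma norm_berLinearMap (hα : 0 < α) (f : HardySpace) :
    ‖berLinearMap hα f‖ = Real.sqrt (berConst α) * ‖f‖ := by
  calc ‖berLinearMap hα f‖ = (eLpNorm (Ber α f) 2 (bergmanMeasure (2 * α + 1))).toReal :=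
        Lp.norm_toLp _ (ber_mem_bergmanSpace hα f).2
    _ = Real.sqrt (berConst α) * (hardyENorm f).toReal := by
        rw [eLpNorm_ber hα, ENNReal.toReal_mul, ENNReal.toReal_ofReal (Real.sqrt_nonneg _)]

theorem BergmanSpace.exists_apply_eq_fourierLaplace (hα : 0 < α) (F : BergmanSpace (2 * α + 1)) :
    ∃ h : ℝ → ℂ, (∀ ξ ≤ 0, h ξ = 0) ∧ MemLp h 2 volume ∧
      ∀ z : ℍ, (F : ℍ → ℂ) z = fourierLaplace (berWeight α • h) z := by
  obtain ⟨g, hg, hF⟩ := (BergmanSpace.isSquareIntegrableAbove F).exists_apply_eq_fourierLaplace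
  have h0 : ∀ ξ ≤ 0, ((berWeight α)⁻¹ • g) ξ = 0 := fun ξ hξ => by simp [hg.eq_zero ξ hξ]
  have hmul : berWeight α • (berWeight α)⁻¹ • g = g := by
    ext ξ
    rcases le_or_gt ξ 0 with hξ | hξ
    · simp [hg.eq_zero ξ hξ]
    · exact smul_inv_smul₀ (berWeight_pos α hξ).ne' (g ξ)
  refine ⟨(berWeight α)⁻¹ • g, h0,
    ⟨(measurable_berWeight α).inv.aestronglyMeasurable.smul hg.aestronglyMeasurable, ?_⟩,
    by rwa [hmul]⟩
  have hfin := F.2.2.2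
  rw [funext hF, ← hmul, eLpNorm_bergmanMeasure_berWeight_smul hα h0 (hmul.symm ▸ hg)] at hfin
  exact ENNReal.lt_top_of_mul_ne_top_right hfin.ne
    (ENNReal.ofReal_pos.2 (Real.sqrt_pos.2 (berConst_pos hα))).ne'

lemma berLinearMap_surjective (hα : 0 < α) : Function.Surjective (berLinearMap hα) := by
  intro F
  obtain ⟨h, h0, h2, hF⟩ := BergmanSpace.exists_apply_eq_fourierLaplace hα F
  have hf : HasHardyDensity (fun z : ℍ => fourierLaplace h z) h := ⟨h0, h2, fun _ => rfl⟩
  refine ⟨⟨_, hf.mem_hardySpace⟩, Subtype.ext (funext fun z => ?_)⟩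
  exact (ber_eq_fourierLaplace α hf z).trans (hF z).symm

/-- The Bergman transform divided by `√K_α`, as a linear isometry. -/
def berIsometry (hα : 0 < α) : HardySpace →ₗᵢ[ℂ] BergmanSpace (2 * α + 1) where
  toLinearMap := (Real.sqrt (berConst α) : ℂ)⁻¹ • berLinearMap hα
  norm_map' f := by
    have hpos := Real.sqrt_pos.2 (berConst_pos hα)
    rw [LinearMap.smul_apply, norm_smul, norm_berLinearMap, norm_inv, Complex.norm_real,
      Real.norm_of_nonneg hpos.le, inv_mul_cancel_left₀ hpos.ne']

lemma sqrt_berConst_smul_berIsometry (hα : 0 < α) (f : HardySpace) :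
    (Real.sqrt (berConst α) : ℂ) • berIsometry hα f = berLinearMap hα f :=
  smul_inv_smul₀ (Complex.ofReal_ne_zero.2 (Real.sqrt_pos.2 (berConst_pos hα)).ne') _

lemma berIsometry_surjective (hα : 0 < α) : Function.Surjective (berIsometry hα) := fun F => by
  obtain ⟨f, hf⟩ := berLinearMap_surjective hα ((Real.sqrt (berConst α) : ℂ) • F)
  refine ⟨f, smul_right_injective _
    (Complex.ofReal_ne_zero.2 (Real.sqrt_pos.2 (berConst_pos hα)).ne') ?_⟩
  exact (sqrt_berConst_smul_berIsometry hα f).trans hf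

end BergmanIsometry

end BergmanTransform

end

theorem mainTheorem4 (α : ℝ) (hα : 0 < α) :
    (∀ f : BergmanTransform.HardySpace,
      Tendsto (BergmanTransform.sliceL2 f) BergmanTransform.heightToZero
        (𝓝 (BergmanTransform.boundary f))) ∧
    (∀ (f : BergmanTransform.HardySpace) (z : ℍ),
      IntegrableOn (BergmanTransform.berIntegrand α f z) (Set.Ioi (0 : ℝ))) ∧
    ∃ e : BergmanTransform.HardySpace ≃ₗᵢ[ℂ] BergmanTransform.BergmanSpace (2 * α + 1),
      ∀ (f : BergmanTransform.HardySpace) (z : ℍ),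
        BergmanTransform.Ber α f z =
          (Real.sqrt (2 * Real.pi * Real.Gamma (2 * α) / 4 ^ α) : ℂ) *
            (e f : ℍ → ℂ) z := by
  refine ⟨BergmanTransform.tendsto_boundary, BergmanTransform.integrableOn_berIntegrand hα,
    LinearIsometryEquiv.ofSurjective (BergmanTransform.berIsometry hα)
      (BergmanTransform.berIsometry_surjective hα), fun f z => ?_⟩
  have hber := BergmanTransform.sqrt_berConst_smul_berIsometry hα f
  exact congrFun (congrArg Subtype.val hber.symm) z
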